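/- Let $\mathbb{F}_q$ be a finite field with $q$ elements. For a finite-dimensional $\mathbb{F}_q$-Lie algebra $L$ and $s\in\mathbb{C}$ put $$\zeta_L^{\triangleleft}(s)=\sum_{I\triangleleft L}|L:I|^{-s},$$ the sum running over all ideals $I$ of $L$, and write $t=q^{-s}$. Consider the following 4-dimensional Lie algebras over $\mathbb{F}_q$ with basis $e_1,e_2,e_3,e_4$; up to anti-symmetry, all unlisted products of basis elements are zero. - $M^1$: abelian. - $M^2$: $[e_4,e_1]=e_1$, $[e_4,e_2]=e_2$, $[e_4,e_3]=e_3$. - $M^3_a$ ($a\in\mathbb{F}_q$): $[e_4,e_1]=e_1$, $[e_4,e_2]=e_3$, $[e_4,e_3]=-ae_2+(a+1)e_3$. - $M^4$: $[e_4,e_2]=e_3$, $[e_4,e_3]=e_3$. - $M^5$: $[e_4,e_2]=e_3$. - $M^6_{a,b}$ ($a,b\in\mathbb{F}_q$): $[e_4,e_1]=e_2$, $[e_4,e_2]=e_3$, $[e_4,e_3]=ae_1+be_2+e_3$. - $M^7_{a,b}$ ($a,b\in\mathbb{F}_q$): $[e_4,e_1]=e_2$, $[e_4,e_2]=e_3$,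 $[e_4,e_3]=-ae_1+be_2$. - $M^8$: $[e_1,e_2]=e_2$, $[e_3,e_4]=e_4$. - $M^9_a$ ($a\in\mathbb{F}_q$ such that $x^2-x-a$ has no root in $\mathbb{F}_q$): $[e_4,e_1]=e_1+ae_2$, $[e_4,e_2]=e_1$, $[e_3,e_1]=e_1$, $[e_3,e_2]=e_2$. - $M^{12}$: $[e_4,e_1]=e_1$, $[e_4,e_2]=2e_2$, $[e_4,e_3]=e_3$, $[e_3,e_1]=e_2$. - $M^{13}_a$ ($a\in\mathbb{F}_q$): $[e_4,e_1]=e_1+ae_3$, $[e_4,e_2]=e_2$, $[e_4,e_3]=e_1$, $[e_3,e_1]=e_2$. - $M^{14}_a$ ($a\in\mathbb{F}_q^\times$): $[e_4,e_1]=ae_3$, $[e_4,e_3]=e_1$, $[e_3,e_1]=e_2$. Define the following numbers of roots: $$\begin{aligned} |V_{3,a}|&=|\{x\in\mathbb{F}_q: ax^2-x-1=0\}|, & |V_{4,a}|&=|\{x\in\mathbb{F}_q: ax^2-1=0\}|,\\ |V^{(1)}_{6,a,b}|&=|\{x\in\mathbb{F}_q: -a^2x^3+ax^2+bx+1=0\}|,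 & |V^{(2)}_{6,a,b}|&=|\{x\in\mathbb{F}_q: ax^3-bx^2+x+1=0\}|,\\ |V^{(1)}_{7,a,b}|&=|\{x\in\mathbb{F}_q: a^2x^3-bx-1=0\}|, & |V^{(2)}_{7,a,b}|&=|\{x\in\mathbb{F}_q: ax^3-bx^2+1=0\}|,\\ |V_{13,a}|&=|\{x\in\mathbb{F}_q: x^2+x-a=0\}|, & |V_{14,a}|&=|\{x\in\mathbb{F}_q: x^2-a=0\}|. \end{aligned}$$ Theorem (Dimension 4, ideals). For all $a,b\in\mathbb{F}_q^\times$ and all $s\in\mathbb{C}$, $$\begin{aligned} \zeta^{\triangleleft}_{M^1}(s)&=1+(1+q+q^2+q^3)t+(1+q+q^2)(1+q^2)t^2+(1+q+q^2+q^3)t^3+t^4,\\ \zeta^{\triangleleft}_{M^2}(s)&=1+t+(1+q+q^2)t^2+(1+q+q^2)t^3+t^4,\\ \zeta^{\triangleleft}_{M^3_a}(s)&=1+t+(2+q)t^2+(2+q)t^3+t^4\quad(a\neq1),\\ \zeta^{\triangleleft}_{M^3_1}(s)&=1+t+(1+q)t^2+(1+q)t^3+t^4,\\ \zeta^{\triangleleft}_{M^3_0}(s)&=1+(1+q)t+(2+q)t^2+(2+q)t^3+t^4,\\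 \zeta^{\triangleleft}_{M^4}(s)&=1+(1+q+q^2)t+(2+q+q^2)t^2+(2+q)t^3+t^4,\\ \zeta^{\triangleleft}_{M^5}(s)&=1+(1+q+q^2)t+(1+q+q^2)t^2+(1+q)t^3+t^4,\\ \zeta^{\triangleleft}_{M^6_{a,b}}(s)&=1+t+|V^{(2)}_{6,a,b}|t^2+|V^{(1)}_{6,a,b}|t^3+t^4,\\ \zeta^{\triangleleft}_{M^6_{a,0}}(s)&=1+t+|V^{(2)}_{6,a,0}|t^2+|V^{(1)}_{6,a,0}|t^3+t^4,\\ \zeta^{\triangleleft}_{M^6_{0,b}}(s)&=1+(1+q)t+(1+|V_{3,b}|)t^2+(1+|V_{3,b}|)t^3+t^4,\\ \zeta^{\triangleleft}_{M^6_{0,0}}(s)&=1+(1+q)t+2t^2+2t^3+t^4,\\ \zeta^{\triangleleft}_{M^7_{a,b}}(s)&=1+t+|V^{(2)}_{7,a,b}|t^2+|V^{(1)}_{7,a,b}|t^3+t^4,\\ \zeta^{\triangleleft}_{M^7_{a,0}}(s)&=1+t+|V^{(2)}_{7,a,0}|t^2+|V^{(1)}_{7,a,0}|t^3+t^4,\\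 \zeta^{\triangleleft}_{M^7_{0,b}}(s)&=1+(1+q)t+(1+|V_{4,b}|)t^2+(1+|V_{4,b}|)t^3+t^4,\\ \zeta^{\triangleleft}_{M^7_{0,0}}(s)&=1+(1+q)t+t^2+t^3+t^4,\\ \zeta^{\triangleleft}_{M^8}(s)&=1+(1+q)t+3t^2+2t^3+t^4,\\ \zeta^{\triangleleft}_{M^9_a}(s)&=1+(1+q)t+t^2+t^4\quad(x^2-x-a\text{ without roots in }\mathbb{F}_q),\\ \zeta^{\triangleleft}_{M^{12}}(s)&=1+t+(1+q)t^2+t^3+t^4,\\ \zeta^{\triangleleft}_{M^{13}_a}(s)&=1+t+|V_{13,a}|t^2+t^3+t^4,\\ \zeta^{\triangleleft}_{M^{13}_0}(s)&=1+(1+q)t+2t^2+t^3+t^4,\\ \zeta^{\triangleleft}_{M^{14}_a}(s)&=1+t+|V_{14,a}|t^2+t^3+t^4. \end{aligned}$$ -/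

import Mathlib

universe u

namespace SolvableLie

section Algebras

variable {F : Type u} [Field F]

/-- The alternating bilinear product on `F ^ 4` in which the listed products are `[e_i, e_j] = rel i j`.
Only one of the two orders of a pair is listed, and unlisted products are `0`, so that
`[e_i, e_j] = rel i j - rel j i`. Coordinates and indices are counted from `0`: `e_1` is index `0`. -/
def tableBracket (rel : Fin 4 → Fin 4 → Fin 4 → F) (x y : Fin 4 → F) : Fin 4 → F :=
  ∑ i, ∑ j, (x i * y j - x j * y i) • rel i j

theorem tableBracket_single (rel : Fin 4 → Fin 4 → Fin 4 → F) (i j : Fin 4) :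
    tableBracket rel (Pi.single i 1) (Pi.single j 1) = rel i j - rel j i := by
  simp only [tableBracket, sub_smul, Finset.sum_sub_distrib]
  congr 1
  · simp [Pi.single_apply]
  · rw [Finset.sum_comm]
    simp [Pi.single_apply]

variable (F) in
/-- A presentation `⟨e_1, e_2, e_3, e_4 : [e_i, e_j] = rel i j⟩` of a Lie algebra of dimension 4. -/
structure Presentation where
  rel : Fin 4 → Fin 4 → Fin 4 → F
  jacobi : ∀ x y z : Fin 4 → F, tableBracket rel x (tableBracket rel y z) =
    tableBracket rel (tableBracket rel x y) z + tableBracket rel y (tableBracket rel x z)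

/-- The Lie algebra of a presentation: the space `F ^ 4` with the bracket of the presentation. -/
def Presentation.Alg (_P : Presentation F) : Type u := Fin 4 → F

instance (P : Presentation F) : AddCommGroup P.Alg := inferInstanceAs (AddCommGroup (Fin 4 → F))

instance (P : Presentation F) : Module F P.Alg := inferInstanceAs (Module F (Fin 4 → F))

instance (P : Presentation F) : LieRing P.Alg where
  bracket x y := tableBracket P.rel x y
  add_lie x y z := by
    change tableBracket P.rel (fun i => x i + y i) z
      = tableBracket P.rel x z + tableBracket P.rel y z
    simp only [tableBracket, ← Finset.sum_add_distrib, ← add_smul]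
    refine Finset.sum_congr rfl fun i _ => Finset.sum_congr rfl fun j _ => ?_
    congr 1
    ring
  lie_add x y z := by
    change tableBracket P.rel x (fun i => y i + z i)
      = tableBracket P.rel x y + tableBracket P.rel x z
    simp only [tableBracket, ← Finset.sum_add_distrib, ← add_smul]
    refine Finset.sum_congr rfl fun i _ => Finset.sum_congr rfl fun j _ => ?_
    congr 1
    ring
  lie_self x := by
    change tableBracket P.rel x x = (0 : Fin 4 → F)
    refine Finset.sum_eq_zero fun i _ => Finset.sum_eq_zero fun j _ => ?_
    rw [mul_comm (x j) (x i), sub_self, zero_smul]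
  leibniz_lie x y z := P.jacobi x y z

instance (P : Presentation F) : LieAlgebra F P.Alg where
  lie_smul c x y := by
    change tableBracket P.rel x (fun i => c * y i) = c • tableBracket P.rel x y
    simp only [tableBracket, Finset.smul_sum, smul_smul]
    refine Finset.sum_congr rfl fun i _ => Finset.sum_congr rfl fun j _ => ?_
    congr 1
    ring

variable (F) in
/-- `M^1`: the abelian Lie algebra. -/
def M1 : Presentation F where
  rel := 0
  jacobi x y z := by simp [tableBracket]

variable (F) in
/-- `M^2`: `[e_4, e_1] = e_1`, `[e_4, e_2] = e_2`, `[e_4, e_3] = e_3`. -/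
def M2 : Presentation F where
  rel := ![0, 0, 0, ![![1, 0, 0, 0], ![0, 1, 0, 0], ![0, 0, 1, 0], 0]]
  jacobi x y z := by
    ext i; fin_cases i <;> simp [tableBracket, Fin.sum_univ_four] <;> ring

/-- `M^3_a`: `[e_4, e_1] = e_1`, `[e_4, e_2] = e_3`, `[e_4, e_3] = -a e_2 + (a + 1) e_3`. -/
def M3 (a : F) : Presentation F where
  rel := ![0, 0, 0, ![![1, 0, 0, 0], ![0, 0, 1, 0], ![0, -a, a + 1, 0], 0]]
  jacobi x y z := by
    ext i; fin_cases i <;> simp [tableBracket, Fin.sum_univ_four] <;> ring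

variable (F) in
/-- `M^4`: `[e_4, e_2] = e_3`, `[e_4, e_3] = e_3`. -/
def M4 : Presentation F where
  rel := ![0, 0, 0, ![0, ![0, 0, 1, 0], ![0, 0, 1, 0], 0]]
  jacobi x y z := by
    ext i; fin_cases i <;> simp [tableBracket, Fin.sum_univ_four] <;> ring

variable (F) in
/-- `M^5`: `[e_4, e_2] = e_3`. -/
def M5 : Presentation F where
  rel := ![0, 0, 0, ![0, ![0, 0, 1, 0], 0, 0]]
  jacobi x y z := by
    ext i; fin_cases i <;> simp [tableBracket, Fin.sum_univ_four]

/-- `M^6_{a,b}`: `[e_4, e_1] = e_2`, `[e_4, e_2] = e_3`, `[e_4, e_3] = a e_1 + b e_2 + e_3`. -/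
def M6 (a b : F) : Presentation F where
  rel := ![0, 0, 0, ![![0, 1, 0, 0], ![0, 0, 1, 0], ![a, b, 1, 0], 0]]
  jacobi x y z := by
    ext i; fin_cases i <;> simp [tableBracket, Fin.sum_univ_four] <;> ring

/-- `M^7_{a,b}`: `[e_4, e_1] = e_2`, `[e_4, e_2] = e_3`, `[e_4, e_3] = -a e_1 + b e_2`. -/
def M7 (a b : F) : Presentation F where
  rel := ![0, 0, 0, ![![0, 1, 0, 0], ![0, 0, 1, 0], ![-a, b, 0, 0], 0]]
  jacobi x y z := by
    ext i; fin_cases i <;> simp [tableBracket, Fin.sum_univ_four] <;> ring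

variable (F) in
/-- `M^8`: `[e_1, e_2] = e_2`, `[e_3, e_4] = e_4`. -/
def M8 : Presentation F where
  rel := ![![0, ![0, 1, 0, 0], 0, 0], 0, ![0, 0, 0, ![0, 0, 0, 1]], 0]
  jacobi x y z := by
    ext i; fin_cases i <;> simp [tableBracket, Fin.sum_univ_four] <;> ring

/-- `M^9_a`: `[e_4, e_1] = e_1 + a e_2`, `[e_4, e_2] = e_1`, `[e_3, e_1] = e_1`,
`[e_3, e_2] = e_2`. -/
def M9 (a : F) : Presentation F where
  rel := ![0, 0, ![![1, 0, 0, 0], ![0, 1, 0, 0], 0, 0], ![![1, a, 0, 0], ![1, 0, 0, 0], 0, 0]]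
  jacobi x y z := by
    ext i; fin_cases i <;> simp [tableBracket, Fin.sum_univ_four] <;> ring

variable (F) in
/-- `M^12`: `[e_4, e_1] = e_1`, `[e_4, e_2] = 2 e_2`, `[e_4, e_3] = e_3`, `[e_3, e_1] = e_2`. -/
def M12 : Presentation F where
  rel := ![0, 0, ![![0, 1, 0, 0], 0, 0, 0], ![![1, 0, 0, 0], ![0, 2, 0, 0], ![0, 0, 1, 0], 0]]
  jacobi x y z := by
    ext i; fin_cases i <;> simp [tableBracket, Fin.sum_univ_four] <;> ring

/-- `M^13_a`: `[e_4, e_1] = e_1 + a e_3`, `[e_4, e_2] = e_2`, `[e_4, e_3] = e_1`,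
`[e_3, e_1] = e_2`. -/
def M13 (a : F) : Presentation F where
  rel := ![0, 0, ![![0, 1, 0, 0], 0, 0, 0], ![![1, 0, a, 0], ![0, 1, 0, 0], ![1, 0, 0, 0], 0]]
  jacobi x y z := by
    ext i; fin_cases i <;> simp [tableBracket, Fin.sum_univ_four] <;> ring

/-- `M^14_a`: `[e_4, e_1] = a e_3`, `[e_4, e_3] = e_1`, `[e_3, e_1] = e_2`. -/
def M14 (a : F) : Presentation F where
  rel := ![0, 0, ![![0, 1, 0, 0], 0, 0, 0], ![![0, 0, a, 0], 0, ![1, 0, 0, 0], 0]]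
  jacobi x y z := by
    ext i; fin_cases i <;> simp [tableBracket, Fin.sum_univ_four] <;> ring

end Algebras

section RootCounts

variable {F : Type u} [Field F]

/-- `|V_{3,a}(F)|` -/
noncomputable def V3 (a : F) : ℕ := {x : F | a * x ^ 2 - x - 1 = 0}.ncard

/-- `|V_{4,a}(F)|` -/
noncomputable def V4 (a : F) : ℕ := {x : F | a * x ^ 2 - 1 = 0}.ncard

/-- `|V^{(1)}_{6,a,b}(F)|` -/
noncomputable def V6one (a b : F) : ℕ :=
  {x : F | -a ^ 2 * x ^ 3 + a * x ^ 2 + b * x + 1 = 0}.ncard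

/-- `|V^{(2)}_{6,a,b}(F)|` -/
noncomputable def V6two (a b : F) : ℕ := {x : F | a * x ^ 3 - b * x ^ 2 + x + 1 = 0}.ncard

/-- `|V^{(1)}_{7,a,b}(F)|` -/
noncomputable def V7one (a b : F) : ℕ := {x : F | a ^ 2 * x ^ 3 - b * x - 1 = 0}.ncard

/-- `|V^{(2)}_{7,a,b}(F)|` -/
noncomputable def V7two (a b : F) : ℕ := {x : F | a * x ^ 3 - b * x ^ 2 + 1 = 0}.ncard

/-- `|V_{13,a}(F)|` -/
noncomputable def V13 (a : F) : ℕ := {x : F | x ^ 2 + x - a = 0}.ncard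

/-- `|V_{14,a}(F)|` -/
noncomputable def V14 (a : F) : ℕ := {x : F | x ^ 2 - a = 0}.ncard

end RootCounts

/-- The ideal zeta function `∑_{I ideal of L} |L : I| ^ (-s)` of a finite Lie algebra `L`;
the sum is over the finitely many ideals of `L`, and `|L : I|` is the index of additive groups. -/
noncomputable def idealZeta (F : Type u) (L : Type u) [Field F] [LieRing L] [LieAlgebra F L]
    (s : ℂ) : ℂ :=
  ∑ᶠ I : LieIdeal F L, (I.toSubmodule.toAddSubgroup.index : ℂ) ^ (-s)

end SolvableLie

/-! Over a finite field the subspaces can be listed: each is the row space of exactly one reduced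
echelon matrix (`exists_isReduced`, `IsReduced.ext`). Keeping echelon matrices square, with every
pivot on the diagonal, makes them idempotent. The row space is then the fixed space of `x ↦ x ᵥ* R`,
and being an ideal becomes a system of polynomial equations in the free entries. The index is `q` to
the number of missing pivots (`IsReduced.index_fixedSpace`), so the zeta function is a polynomial in
`t` whose coefficients count solutions over the sixteen pivot patterns (`idealZeta_eq_cells`).

All the algebras except `M8` and `M9` extend N = ⟨e_1, e_2, e_3⟩, abelian (h = 0) or Heisenberg (h =
1), by a derivation d = ad e_4. Placing e_4 first in the column order separates the ideals inside N,
which are the d-invariant ideals of N, from those containing some e_4 + u, which must also contain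
[e_4 + u, N]. `idealZeta_eq_of_rel` states the resulting equations once for all h and d.

What remains is linear algebra: counting invariant lines and planes of d, or eigenlines of d on N
modulo its centre in the Heisenberg case. The root counts `V3`, ..., `V14` are numbers of
eigenvalues in the coordinates of the echelon form. -/

namespace SolvableLie
open Matrix

/-! ### Subspaces as square reduced echelon matrices -/

section Echelon

variable {F : Type*} [Field F] {n : Type*}

/-- A square matrix in reduced echelon form, with row `i` either zero or having its pivot in column
`i`. The columns are ordered by `ρ`. -/
structure IsReduced (ρ : n → ℕ) (R : Matrix n n F) : Prop where
  lower : ∀ i j, ρ j < ρ i → R i j = 0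
  diag : ∀ i, R i i = 0 ∨ R i i = 1
  row : ∀ i, R i i = 0 → R i = 0
  col : ∀ i j, R i i = 1 → j ≠ i → R j i = 0

variable [Fintype n]

theorem IsReduced.vecMul_pivot {ρ : n → ℕ} {R : Matrix n n F} (hR : IsReduced ρ R) (x : n → F)
    {i : n} (hi : R i i = 1) : (x ᵥ* R) i = x i := by
  rw [vecMul, dotProduct, Finset.sum_eq_single i, hi, mul_one]
  · intro j _ hj
    rw [hR.col i j hi hj, mul_zero]
  · simp

/-- Row `i` has a 1 at its own pivot and 0 at all other pivots, so multiplying by `R` merely selects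
row `i` again. Thus `R` is idempotent, which is why its fixed space is its row space. -/
theorem IsReduced.row_vecMul {ρ : n → ℕ} {R : Matrix n n F} (hR : IsReduced ρ R) (i : n) :
    R i ᵥ* R = R i := by
  rcases hR.diag i with hi | hi
  · rw [hR.row i hi, zero_vecMul]
  · ext k
    rw [vecMul, dotProduct, Finset.sum_eq_single i, hi, one_mul]
    · intro j _ hj
      rcases hR.diag j with h | h
      · rw [hR.row j h, Pi.zero_apply, mul_zero]
      · rw [hR.col j i h hj.symm, zero_mul]
    · simp

/-- The row space of `R`, for `R` in reduced echelon form. -/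
def fixedSpace (R : Matrix n n F) : Submodule F (n → F) where
  carrier := {x | x ᵥ* R = x}
  add_mem' {x y} hx hy := by
    simp only [Set.mem_ofPred_eq] at *
    rw [add_vecMul, hx, hy]
  zero_mem' := zero_vecMul R
  smul_mem' c x hx := by
    simp only [Set.mem_ofPred_eq] at *
    rw [smul_vecMul, hx]

theorem mem_fixedSpace {R : Matrix n n F} {x : n → F} : x ∈ fixedSpace R ↔ x ᵥ* R = x := Iff.rfl

/-- Pivots are the leading positions of vectors of the space, hence depend on the space alone. For a
vector with leading 1 at `i`, triangularity reduces coordinate `i` of the product to `R i i`. -/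
theorem IsReduced.diag_eq_one_iff {ρ : n → ℕ} (hρ : ρ.Injective) {R : Matrix n n F}
    (hR : IsReduced ρ R) (i : n) :
    R i i = 1 ↔ ∃ x ∈ fixedSpace R, x i = 1 ∧ ∀ j, ρ j < ρ i → x j = 0 := by
  refine ⟨fun hi => ⟨R i, hR.row_vecMul i, hi, hR.lower i⟩, ?_⟩
  rintro ⟨x, hx, hxi, hxj⟩
  have h := congrFun (mem_fixedSpace.1 hx) i
  rw [vecMul, dotProduct, Finset.sum_eq_single i, hxi, one_mul] at h
  · exact h
  · intro j _ hj
    rcases lt_or_gt_of_ne (hρ.ne hj) with h | h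
    · rw [hxj j h, zero_mul]
    · rw [hR.lower j i h, mul_zero]
  · simp

/-- The pivots agree, so the difference of two corresponding rows vanishes at every pivot. Being
fixed by `R`, it is a combination of rows of `R` with coefficients its pivot coordinates, all zero.
-/
theorem IsReduced.ext {ρ : n → ℕ} (hρ : ρ.Injective) {R S : Matrix n n F}
    (hR : IsReduced ρ R) (hS : IsReduced ρ S) (h : fixedSpace R = fixedSpace S) : R = S := by
  have hp : ∀ i, R i i = 1 ↔ S i i = 1 := fun i => by
    rw [hR.diag_eq_one_iff hρ, hS.diag_eq_one_iff hρ, h]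
  funext i
  rcases hR.diag i with hi | hi
  · have hi' : S i i = 0 := (hS.diag i).resolve_right fun h1 => by
      rw [← hp, hi] at h1
      exact zero_ne_one h1
    rw [hR.row i hi, hS.row i hi']
  · have hd : R i - S i ∈ fixedSpace R :=
      sub_mem (hR.row_vecMul i) (h ▸ hS.row_vecMul i)
    rw [mem_fixedSpace] at hd
    rw [← sub_eq_zero, ← hd]
    ext k
    refine Finset.sum_eq_zero fun j _ => ?_
    change (R i j - S i j) * R j k = 0
    rcases hR.diag j with hj | hj
    · rw [hR.row j hj, Pi.zero_apply, mul_zero]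
    · rcases eq_or_ne i j with rfl | hij
      · rw [hi, (hp i).1 hi, sub_self, zero_mul]
      · rw [hR.col j i hj hij, hS.col j i ((hp j).1 hj) hij, sub_self, zero_mul]

/-- Gaussian elimination without a matrix to start from: `p` singles out the leading positions of
vectors of `W`, and each gets a row cleared at all other leading positions. -/
theorem exists_isReduced {ρ : n → ℕ} (hρ : ρ.Injective) (W : Submodule F (n → F)) :
    ∃ R : Matrix n n F, IsReduced ρ R ∧ fixedSpace R = W := by
  classical
  let p : n → Prop := fun i => ∃ x ∈ W, x i = 1 ∧ ∀ j, ρ j < ρ i → x j = 0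
  have hrow : ∀ i, p i → ∃ r ∈ W, r i = 1 ∧ (∀ j, ρ j < ρ i → r j = 0) ∧
      ∀ j, p j → j ≠ i → r j = 0 := by
    obtain ⟨N, hN⟩ : ∃ N, ∀ i, ρ i < N :=
      ⟨Finset.univ.sup ρ + 1, fun i => Nat.lt_succ_of_le (Finset.le_sup (Finset.mem_univ i))⟩
    -- Induction from the last column backwards: the rows of later pivots are already reduced and
    -- serve to clear row `i`. Since `N` is a strict bound, the base case is vacuous.
    have key : ∀ m i, N - ρ i ≤ m → p i → ∃ r ∈ W, r i = 1 ∧ (∀ j, ρ j < ρ i → r j = 0) ∧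
        ∀ j, p j → j ≠ i → r j = 0 := by
      intro m
      induction m with
      | zero => intro i hi; have := hN i; omega
      | succ m ih =>
        intro i hi ⟨x, hxW, hxi, hxj⟩
        -- The default row 0 outside the later pivots makes the choice of rows a total function.
        have ih' : ∀ j, ∃ r ∈ W, ρ i < ρ j → p j → r j = 1 ∧ (∀ k, ρ k < ρ j → r k = 0) ∧
            ∀ k, p k → k ≠ j → r k = 0 := by
          intro j
          by_cases h : ρ i < ρ j ∧ p j
          · have := hN j
            obtain ⟨r, hr, h1⟩ := ih j (by omega) h.2
            exact ⟨r, hr, fun _ _ => h1⟩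
          · exact ⟨0, W.zero_mem, fun h1 h2 => absurd ⟨h1, h2⟩ h⟩
        choose r hrW hr using ih'
        let s := Finset.univ.filter fun j => ρ i < ρ j ∧ p j
        have hs : ∀ j, j ∈ s ↔ ρ i < ρ j ∧ p j := fun j => by simp [s]
        refine ⟨x - ∑ j ∈ s, x j • r j,
          W.sub_mem hxW (W.sum_mem fun j _ => W.smul_mem _ (hrW j)), ?_, ?_, ?_⟩
        · rw [Pi.sub_apply, hxi, Finset.sum_apply, Finset.sum_eq_zero, sub_zero]
          intro j hj
          obtain ⟨h1, h2⟩ := (hs j).1 hj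
          rw [Pi.smul_apply, (hr j h1 h2).2.1 i h1, smul_zero]
        · intro k hk
          rw [Pi.sub_apply, hxj k hk, Finset.sum_apply, Finset.sum_eq_zero, sub_zero]
          intro j hj
          obtain ⟨h1, h2⟩ := (hs j).1 hj
          rw [Pi.smul_apply, (hr j h1 h2).2.1 k (hk.trans h1), smul_zero]
        · intro k hk hki
          rw [Pi.sub_apply, Finset.sum_apply]
          rcases lt_or_gt_of_ne (hρ.ne hki) with h | h
          · rw [hxj k h, Finset.sum_eq_zero, sub_zero]
            intro j hj
            obtain ⟨h1, h2⟩ := (hs j).1 hj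
            rw [Pi.smul_apply, (hr j h1 h2).2.1 k (h.trans h1), smul_zero]
          · rw [Finset.sum_eq_single k, Pi.smul_apply, (hr k h hk).1, smul_eq_mul, mul_one,
              sub_self]
            · intro j hj hjk
              obtain ⟨h1, h2⟩ := (hs j).1 hj
              rw [Pi.smul_apply, (hr j h1 h2).2.2 k hk hjk.symm, smul_zero]
            · exact fun hk' => absurd ((hs k).2 ⟨h, hk⟩) hk'
    exact fun i => key _ i le_rfl
  have hrow' : ∀ i, ∃ r ∈ W, (¬ p i → r = 0) ∧ (p i → r i = 1 ∧ (∀ j, ρ j < ρ i → r j = 0) ∧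
      ∀ j, p j → j ≠ i → r j = 0) := by
    intro i
    by_cases h : p i
    · obtain ⟨r, hr, h1⟩ := hrow i h
      exact ⟨r, hr, fun h2 => absurd h h2, fun _ => h1⟩
    · exact ⟨0, W.zero_mem, fun _ => rfl, fun h2 => absurd h2 h⟩
  choose R hRW hR0 hR1 using hrow'
  have hdiag : ∀ i, R i i = 1 ↔ p i := fun i =>
    ⟨fun h => by
      by_contra h1
      rw [hR0 i h1] at h
      exact zero_ne_one h, fun h => (hR1 i h).1⟩
  have hred : IsReduced ρ (of R) := by
    constructor
    · intro i j hij
      rw [of_apply]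
      by_cases h : p i
      · exact (hR1 i h).2.1 j hij
      · rw [hR0 i h]; rfl
    · intro i
      rw [of_apply]
      by_cases h : p i
      · exact Or.inr (hR1 i h).1
      · left; rw [hR0 i h]; rfl
    · intro i hi
      refine hR0 i fun h => ?_
      rw [of_apply, (hR1 i h).1] at hi
      exact one_ne_zero hi
    · intro i j hi hji
      rw [of_apply]
      by_cases h : p j
      · exact (hR1 j h).2.2 i ((hdiag i).1 hi) hji.symm
      · rw [hR0 j h]; rfl
  have hmem : ∀ x, x ᵥ* of R ∈ W := by
    intro x
    rw [vecMul_eq_sum]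
    exact W.sum_mem fun i _ => W.smul_mem _ (hRW i)
  refine ⟨of R, hred, le_antisymm (fun x hx => ?_) (fun x hx => ?_)⟩
  · rw [← mem_fixedSpace.1 hx]
    exact hmem x
  -- The remainder `x - x ᵥ* R` lies in `W` and vanishes at every pivot. If it were nonzero, its
  -- first nonzero position would itself be a pivot.
  · by_contra hne
    have hd : x - x ᵥ* of R ∈ W := W.sub_mem hx (hmem x)
    set d := x - x ᵥ* of R with hd_def
    have hd0 : d ≠ 0 := fun h => hne (sub_eq_zero.1 h).symm
    obtain ⟨i, hi⟩ := Function.ne_iff.1 hd0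
    obtain ⟨k, hk, hmin⟩ := Finset.exists_min_image (Finset.univ.filter fun j => d j ≠ 0) ρ
      ⟨i, by simpa using hi⟩
    simp only [Finset.mem_filter, Finset.mem_univ, true_and] at hk hmin
    have hpk : p k := by
      refine ⟨(d k)⁻¹ • d, W.smul_mem _ hd, ?_, fun j hj => ?_⟩
      · rw [Pi.smul_apply, smul_eq_mul, inv_mul_cancel₀ hk]
      · rw [Pi.smul_apply]
        by_contra h
        exact absurd (hmin j fun h1 => h (by rw [h1, smul_zero])) (not_le.2 hj)
    refine hk ?_
    rw [hd_def, Pi.sub_apply, hred.vecMul_pivot x ((hdiag k).2 hpk), sub_self]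

/-- The quotient is identified with the non-pivot coordinates through `x ↦ x - x ᵥ* R`. This is onto
because a vector supported on the zero rows is killed by `R`. -/
theorem IsReduced.index_fixedSpace {ρ : n → ℕ} {R : Matrix n n F} (hR : IsReduced ρ R) :
    (fixedSpace R).toAddSubgroup.index = Nat.card F ^ Nat.card {i // R i i = 0} := by
  classical
  let φ : (n → F) →+ ({i // R i i = 0} → F) :=
    { toFun := fun x i => x i - (x ᵥ* R) i
      map_zero' := by ext i; simp
      map_add' := fun x y => by
        ext i
        simp only [add_vecMul, Pi.add_apply]
        ring }
  have hker : φ.ker = (fixedSpace R).toAddSubgroup := by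
    ext x
    refine ⟨fun hx => ?_, fun hx => ?_⟩
    · refine mem_fixedSpace.2 (funext fun i => ?_)
      rcases hR.diag i with hi | hi
      · exact (sub_eq_zero.1 (congrFun hx ⟨i, hi⟩)).symm
      · exact hR.vecMul_pivot x hi
    · refine funext fun i => ?_
      exact sub_eq_zero.2 (congrFun (mem_fixedSpace.1 hx) i).symm
  have hsurj : Function.Surjective φ := by
    intro y
    let x : n → F := fun i => if hi : R i i = 0 then y ⟨i, hi⟩ else 0
    have hx : x ᵥ* R = 0 := by
      ext k
      refine Finset.sum_eq_zero fun j _ => ?_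
      change x j * R j k = 0
      by_cases hj : R j j = 0
      · rw [hR.row j hj, Pi.zero_apply, mul_zero]
      · simp [x, hj]
    refine ⟨x, funext fun i => ?_⟩
    change x i - (x ᵥ* R) i = y i
    rw [hx, Pi.zero_apply, sub_zero]
    simp [x, i.2]
  rw [← hker, AddSubgroup.index_ker, AddMonoidHom.range_eq_top.2 hsurj, AddSubgroup.card_top,
    Nat.card_fun]

end Echelon

/-! ### Ideals as echelon matrices, sorted by pivots -/

section Ideals

variable {F : Type u} [Field F]

/-- The row space of `R` is stable under the bracket with structure constants `rel`. -/
def IsIdeal (rel : Fin 4 → Fin 4 → Fin 4 → F) (R : Matrix (Fin 4) (Fin 4) F) : Prop :=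
  ∀ i j, (∑ k, R i k • (rel j k - rel k j)) ᵥ* R = ∑ k, R i k • (rel j k - rel k j)

theorem tableBracket_single_left (rel : Fin 4 → Fin 4 → Fin 4 → F) (j : Fin 4) (y : Fin 4 → F) :
    tableBracket rel (Pi.single j 1) y = ∑ k, y k • (rel j k - rel k j) := by
  simp only [tableBracket, sub_smul, smul_sub, Finset.sum_sub_distrib]
  congr 1
  · simp [Pi.single_apply]
  · rw [Finset.sum_comm]
    simp [Pi.single_apply]

theorem tableBracket_eq_sum (rel : Fin 4 → Fin 4 → Fin 4 → F) (x y : Fin 4 → F) :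
    tableBracket rel x y = ∑ j, x j • ∑ k, y k • (rel j k - rel k j) := by
  simp only [tableBracket, sub_smul, smul_sub, Finset.sum_sub_distrib, Finset.smul_sum, mul_smul]
  congr 1
  rw [Finset.sum_comm]

/-- By bilinearity it is enough to bracket basis vectors with rows, since a fixed vector `y` is the
combination of the rows with coefficients `y i`. -/
theorem IsIdeal.bracket_mem {rel : Fin 4 → Fin 4 → Fin 4 → F} {R : Matrix (Fin 4) (Fin 4) F}
    (h : IsIdeal rel R) (x : Fin 4 → F) {y : Fin 4 → F} (hy : y ∈ fixedSpace R) :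
    tableBracket rel x y ∈ fixedSpace R := by
  rw [tableBracket_eq_sum]
  refine sum_mem fun j _ => Submodule.smul_mem _ _ ?_
  have hy' : ∀ k, y k = ∑ i, y i * R i k := fun k => (congrFun (mem_fixedSpace.1 hy) k).symm
  have : ∑ k, y k • (rel j k - rel k j) = ∑ i, y i • ∑ k, R i k • (rel j k - rel k j) := by
    simp only [Finset.smul_sum, smul_smul]
    rw [Finset.sum_comm]
    refine Finset.sum_congr rfl fun k _ => ?_
    rw [← Finset.sum_smul, ← hy']
  rw [this]
  exact sum_mem fun i _ => Submodule.smul_mem _ _ (h i j)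

/-- The ideal spanned by the rows of `R`. -/
def rowIdeal (P : Presentation F) (R : Matrix (Fin 4) (Fin 4) F) (h : IsIdeal P.rel R) :
    LieIdeal F P.Alg :=
  { (fixedSpace R : Submodule F (Fin 4 → F)) with
    lie_mem := fun {x _} hm => h.bracket_mem x hm }

theorem rowIdeal_bijective (P : Presentation F) {ρ : Fin 4 → ℕ} (hρ : ρ.Injective) :
    Function.Bijective fun R : {R // IsReduced ρ R ∧ IsIdeal P.rel R} =>
      rowIdeal P R.1 R.2.2 := by
  refine ⟨fun R S h => Subtype.ext (R.2.1.ext hρ S.2.1 ?_), fun I => ?_⟩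
  · exact congrArg (fun J : LieIdeal F P.Alg => J.toSubmodule) h
  · obtain ⟨R, hR, hRI⟩ := exists_isReduced hρ (show Submodule F (Fin 4 → F) from I.toSubmodule)
    have hI : IsIdeal P.rel R := fun i j => by
      rw [← tableBracket_single_left, ← mem_fixedSpace, hRI]
      refine I.lie_mem (x := (Pi.single j 1 : Fin 4 → F)) (m := R i) ?_
      change R i ∈ (show Submodule F (Fin 4 → F) from I.toSubmodule)
      rw [← hRI]
      exact hR.row_vecMul i
    refine ⟨⟨R, hR, hI⟩, ?_⟩
    rw [← LieSubmodule.toSubmodule_inj]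
    exact hRI

theorem natCast_pow_cpow (q k : ℕ) (s : ℂ) : ((q ^ k : ℕ) : ℂ) ^ s = ((q : ℂ) ^ s) ^ k := by
  induction k with
  | zero => simp
  | succ k ih => rw [pow_succ, Nat.cast_mul, Complex.natCast_mul_natCast_cpow, ih, pow_succ]

/-- The diagonal matrix entries of a reduced matrix, as truth values. -/
noncomputable def pivots (R : Matrix (Fin 4) (Fin 4) F) : Bool × Bool × Bool × Bool :=
  open Classical in
  (decide (R 3 3 = 1), decide (R 0 0 = 1), decide (R 1 1 = 1), decide (R 2 2 = 1))

theorem IsReduced.card_diag_zero {ρ : Fin 4 → ℕ} {R : Matrix (Fin 4) (Fin 4) F}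
    (hR : IsReduced ρ R) :
    Nat.card {i // R i i = 0} = (!(pivots R).1).toNat + (!(pivots R).2.1).toNat +
      (!(pivots R).2.2.1).toNat + (!(pivots R).2.2.2).toNat := by
  classical
  have h : ∀ i, (!decide (R i i = 1)).toNat = if R i i = 0 then 1 else 0 := fun i => by
    rcases hR.diag i with h | h <;> simp [h]
  rw [Nat.card_eq_fintype_card, Fintype.card_subtype, Finset.card_filter, Fin.sum_univ_four]
  simp only [pivots, ← h]
  ring

/-- The index depends only on the pivot pattern, so grouping the ideals by pattern leaves a
cardinality times a power of `t` for each. -/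
theorem idealZeta_eq_sum_pivots [Finite F] (P : Presentation F) {ρ : Fin 4 → ℕ}
    (hρ : ρ.Injective) (s : ℂ) :
    idealZeta F P.Alg s = ∑ ε : Bool × Bool × Bool × Bool,
      ({R : Matrix (Fin 4) (Fin 4) F | IsReduced ρ R ∧ IsIdeal P.rel R ∧ pivots R = ε}.ncard : ℂ) *
        ((Nat.card F : ℂ) ^ (-s)) ^ ((!ε.1).toNat + (!ε.2.1).toNat + (!ε.2.2.1).toNat +
          (!ε.2.2.2).toNat) := by
  classical
  have := Fintype.ofFinite {R : Matrix (Fin 4) (Fin 4) F // IsReduced ρ R ∧ IsIdeal P.rel R}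
  rw [idealZeta, ← finsum_eq_of_bijective _ (rowIdeal_bijective P hρ) (fun _ => rfl),
    finsum_eq_sum_of_fintype, ← Finset.sum_fiberwise _ fun R => pivots R.1]
  refine Finset.sum_congr rfl fun ε _ => ?_
  have h : ∀ R ∈ Finset.univ.filter (fun R : {R : Matrix (Fin 4) (Fin 4) F //
      IsReduced ρ R ∧ IsIdeal P.rel R} => pivots R.1 = ε),
      ((rowIdeal P R.1 R.2.2).toSubmodule.toAddSubgroup.index : ℂ) ^ (-s) =
        ((Nat.card F : ℂ) ^ (-s)) ^ ((!ε.1).toNat + (!ε.2.1).toNat + (!ε.2.2.1).toNat +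
          (!ε.2.2.2).toNat) := by
    intro R hR
    rw [← (Finset.mem_filter.1 hR).2, ← R.2.1.card_diag_zero, ← natCast_pow_cpow,
      ← R.2.1.index_fixedSpace]
    rfl
  rw [Finset.sum_congr rfl h, Finset.sum_const, nsmul_eq_mul]
  congr 2
  rw [← Set.ncard_coe_finset, ← Set.ncard_image_of_injective _ Subtype.val_injective]
  congr 1
  ext R
  simp only [Finset.coe_filter, Finset.mem_univ, true_and, Set.mem_image, Set.mem_ofPred_eq,
    Subtype.exists, exists_and_right, exists_eq_right]
  tauto

theorem ncard_isIdeal_pivots {ρ : Fin 4 → ℕ} {α : Type*} (rel : Fin 4 → Fin 4 → Fin 4 → F)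
    (ε : Bool × Bool × Bool × Bool)
    (C : α → Matrix (Fin 4) (Fin 4) F) (hC : C.Injective)
    (h1 : ∀ p, IsReduced ρ (C p) ∧ pivots (C p) = ε)
    (h2 : ∀ R, IsReduced ρ R → pivots R = ε → ∃ p, C p = R) :
    {R | IsReduced ρ R ∧ IsIdeal rel R ∧ pivots R = ε}.ncard = {p | IsIdeal rel (C p)}.ncard := by
  rw [← Set.ncard_image_of_injective _ hC]
  congr 1
  ext R
  constructor
  · rintro ⟨hR, hI, hε⟩
    obtain ⟨p, rfl⟩ := h2 R hR hε
    exact ⟨p, hI, rfl⟩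
  · rintro ⟨p, hI, rfl⟩
    exact ⟨(h1 p).1, hI, (h1 p).2⟩

end Ideals

/-! ### The sixteen Schubert cells of `F ^ 4` -/

section Cells

variable {F : Type u} [Field F]

/-- The order `e_4 < e_1 < e_2 < e_3` of the basis in which echelon forms are taken. -/
def basisRank : Fin 4 → ℕ := ![1, 2, 3, 0]

theorem basisRank_injective : basisRank.Injective := by decide

/-- Spells out reducedness entry by entry, so that membership in a cell can be settled by
simplification. -/
theorem isReduced_basisRank_iff (R : Matrix (Fin 4) (Fin 4) F) :
    IsReduced basisRank R ↔
      (R 0 3 = 0 ∧ R 1 3 = 0 ∧ R 2 3 = 0 ∧ R 1 0 = 0 ∧ R 2 0 = 0 ∧ R 2 1 = 0) ∧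
      ((R 3 3 = 0 ∧ R 3 0 = 0 ∧ R 3 1 = 0 ∧ R 3 2 = 0) ∨ R 3 3 = 1) ∧
      ((R 0 0 = 0 ∧ R 0 1 = 0 ∧ R 0 2 = 0) ∨ (R 0 0 = 1 ∧ R 3 0 = 0)) ∧
      ((R 1 1 = 0 ∧ R 1 2 = 0) ∨ (R 1 1 = 1 ∧ R 3 1 = 0 ∧ R 0 1 = 0)) ∧
      (R 2 2 = 0 ∨ (R 2 2 = 1 ∧ R 3 2 = 0 ∧ R 0 2 = 0 ∧ R 1 2 = 0)) := by
  constructor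
  · intro h
    have hl := fun i j => h.lower i j
    have hr := fun i j (hi : R i i = 0) => congrFun (h.row i hi) j
    have hc := h.col
    have hd := h.diag
    refine ⟨⟨hl _ _ (by decide), hl _ _ (by decide), hl _ _ (by decide), hl _ _ (by decide),
      hl _ _ (by decide), hl _ _ (by decide)⟩, ?_, ?_, ?_, ?_⟩
    · exact (hd 3).imp_left fun h => ⟨h, hr _ _ h, hr _ _ h, hr _ _ h⟩
    · exact (hd 0).imp (fun h => ⟨h, hr _ _ h, hr _ _ h⟩) fun h => ⟨h, hc _ _ h (by decide)⟩
    · exact (hd 1).imp (fun h => ⟨h, hr _ _ h⟩)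
        fun h => ⟨h, hc _ _ h (by decide), hc _ _ h (by decide)⟩
    · exact (hd 2).imp_right
        fun h => ⟨h, hc _ _ h (by decide), hc _ _ h (by decide), hc _ _ h (by decide)⟩
  · rintro ⟨⟨h1, h2, h3, h4, h5, h6⟩, h7, h8, h9, h10⟩
    constructor
    · intro i j hij
      fin_cases i <;> fin_cases j <;> first | assumption | (exact absurd hij (by decide))
    · intro i
      fin_cases i
      · exact h8.imp And.left And.left
      · exact h9.imp And.left And.left
      · exact h10.imp_right And.left
      · exact h7.imp_left And.left
    · intro i hi
      funext j
      fin_cases i <;> fin_cases j <;> simp_all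
    · intro i j hi hj
      fin_cases i <;> fin_cases j <;> simp_all

/-- The reduced matrices with pivots at `e_4`. -/
def cell4 (p : F × F × F) : Matrix (Fin 4) (Fin 4) F :=
  !![0, 0, 0, 0; 0, 0, 0, 0; 0, 0, 0, 0; p.1, p.2.1, p.2.2, 1]

/-- The reduced matrices with pivots at `e_1`. -/
def cell1 (p : F × F) : Matrix (Fin 4) (Fin 4) F :=
  !![1, p.1, p.2, 0; 0, 0, 0, 0; 0, 0, 0, 0; 0, 0, 0, 0]

/-- The reduced matrices with pivots at `e_2`. -/
def cell2 (p : F) : Matrix (Fin 4) (Fin 4) F :=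
  !![0, 0, 0, 0; 0, 1, p, 0; 0, 0, 0, 0; 0, 0, 0, 0]

/-- The reduced matrices with pivots at `e_3`. -/
def cell3 (_ : Unit) : Matrix (Fin 4) (Fin 4) F :=
  !![0, 0, 0, 0; 0, 0, 0, 0; 0, 0, 1, 0; 0, 0, 0, 0]

/-- The reduced matrices with pivots at `e_4`, `e_1`. -/
def cell41 (p : F × F × F × F) : Matrix (Fin 4) (Fin 4) F :=
  !![1, p.1, p.2.1, 0; 0, 0, 0, 0; 0, 0, 0, 0; 0, p.2.2.1, p.2.2.2, 1]

/-- The reduced matrices with pivots at `e_4`, `e_2`. -/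
def cell42 (p : F × F × F) : Matrix (Fin 4) (Fin 4) F :=
  !![0, 0, 0, 0; 0, 1, p.1, 0; 0, 0, 0, 0; p.2.1, 0, p.2.2, 1]

/-- The reduced matrices with pivots at `e_4`, `e_3`. -/
def cell43 (p : F × F) : Matrix (Fin 4) (Fin 4) F :=
  !![0, 0, 0, 0; 0, 0, 0, 0; 0, 0, 1, 0; p.1, p.2, 0, 1]

/-- The reduced matrices with pivots at `e_1`, `e_2`. -/
def cell12 (p : F × F) : Matrix (Fin 4) (Fin 4) F :=
  !![1, 0, p.1, 0; 0, 1, p.2, 0; 0, 0, 0, 0; 0, 0, 0, 0]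

/-- The reduced matrices with pivots at `e_1`, `e_3`. -/
def cell13 (p : F) : Matrix (Fin 4) (Fin 4) F :=
  !![1, p, 0, 0; 0, 0, 0, 0; 0, 0, 1, 0; 0, 0, 0, 0]

/-- The reduced matrices with pivots at `e_2`, `e_3`. -/
def cell23 (_ : Unit) : Matrix (Fin 4) (Fin 4) F :=
  !![0, 0, 0, 0; 0, 1, 0, 0; 0, 0, 1, 0; 0, 0, 0, 0]

/-- The reduced matrices with pivots at `e_4`, `e_1`, `e_2`. -/
def cell412 (p : F × F × F) : Matrix (Fin 4) (Fin 4) F :=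
  !![1, 0, p.1, 0; 0, 1, p.2.1, 0; 0, 0, 0, 0; 0, 0, p.2.2, 1]

/-- The reduced matrices with pivots at `e_4`, `e_1`, `e_3`. -/
def cell413 (p : F × F) : Matrix (Fin 4) (Fin 4) F :=
  !![1, p.1, 0, 0; 0, 0, 0, 0; 0, 0, 1, 0; 0, p.2, 0, 1]

/-- The reduced matrices with pivots at `e_4`, `e_2`, `e_3`. -/
def cell423 (p : F) : Matrix (Fin 4) (Fin 4) F :=
  !![0, 0, 0, 0; 0, 1, 0, 0; 0, 0, 1, 0; p, 0, 0, 1]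

/-- The reduced matrices with pivots at `e_1`, `e_2`, `e_3`. -/
def cell123 (_ : Unit) : Matrix (Fin 4) (Fin 4) F :=
  !![1, 0, 0, 0; 0, 1, 0, 0; 0, 0, 1, 0; 0, 0, 0, 0]

theorem isIdeal_zero (rel : Fin 4 → Fin 4 → Fin 4 → F) : IsIdeal rel 0 := by
  intro i j
  simp

theorem isIdeal_one (rel : Fin 4 → Fin 4 → Fin 4 → F) : IsIdeal rel 1 := by
  intro i j
  simp

/-- Here `g` reads the free entries off a matrix; it is inverse to the parametrization `C` of the
cell. -/
theorem ncard_isIdeal_cell {α : Type*} (rel : Fin 4 → Fin 4 → Fin 4 → F)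
    (ε : Bool × Bool × Bool × Bool) (C : α → Matrix (Fin 4) (Fin 4) F)
    (g : Matrix (Fin 4) (Fin 4) F → α) (h0 : ∀ p, g (C p) = p)
    (h1 : ∀ p, IsReduced basisRank (C p) ∧ pivots (C p) = ε)
    (h2 : ∀ R, IsReduced basisRank R → pivots R = ε → C (g R) = R) :
    {R | IsReduced basisRank R ∧ IsIdeal rel R ∧ pivots R = ε}.ncard =
      {p | IsIdeal rel (C p)}.ncard :=
  ncard_isIdeal_pivots rel ε C (Function.LeftInverse.injective h0) h1
    fun R hR hε => ⟨g R, h2 R hR hε⟩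

-- Each pivot pattern is an affine space of free entries, and its power of `t` is the codimension.
-- The full and the empty pattern have no free entries and give the terms 1 and `t ^ 4`.
set_option maxHeartbeats 1000000 in
theorem idealZeta_eq_cells [Finite F] (P : Presentation F) (s t : ℂ)
    (ht : t = (Nat.card F : ℂ) ^ (-s)) :
    idealZeta F P.Alg s = 1 +
      ({p | IsIdeal P.rel (cell412 p)}.ncard + {p | IsIdeal P.rel (cell413 p)}.ncard +
        {p | IsIdeal P.rel (cell423 p)}.ncard + {p | IsIdeal P.rel (cell123 p)}.ncard : ℕ) * t +
      ({p | IsIdeal P.rel (cell41 p)}.ncard + {p | IsIdeal P.rel (cell42 p)}.ncard +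
        {p | IsIdeal P.rel (cell43 p)}.ncard + {p | IsIdeal P.rel (cell12 p)}.ncard +
        {p | IsIdeal P.rel (cell13 p)}.ncard + {p | IsIdeal P.rel (cell23 p)}.ncard : ℕ) * t ^ 2 +
      ({p | IsIdeal P.rel (cell4 p)}.ncard + {p | IsIdeal P.rel (cell1 p)}.ncard +
        {p | IsIdeal P.rel (cell2 p)}.ncard + {p | IsIdeal P.rel (cell3 p)}.ncard : ℕ) * t ^ 3 +
      t ^ 4 := by
  rw [idealZeta_eq_sum_pivots P basisRank_injective, ← ht]
  simp only [Fintype.sum_prod_type, Fintype.sum_bool]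
  rw [ncard_isIdeal_cell P.rel (true, false, false, false) cell4 (fun R => (R 3 0, R 3 1, R 3 2))
    (fun _ => rfl) (fun p => ⟨by simp [isReduced_basisRank_iff, cell4], by simp [pivots, cell4]⟩)
    (fun R hR hε => by
      simp only [isReduced_basisRank_iff, pivots, Prod.mk.injEq, decide_eq_true_eq,
        decide_eq_false_iff_not] at hR hε
      ext i j; fin_cases i <;> fin_cases j <;> simp_all [cell4])]
  rw [ncard_isIdeal_cell P.rel (false, true, false, false) cell1 (fun R => (R 0 1, R 0 2))
    (fun _ => rfl) (fun p => ⟨by simp [isReduced_basisRank_iff, cell1], by simp [pivots, cell1]⟩)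
    (fun R hR hε => by
      simp only [isReduced_basisRank_iff, pivots, Prod.mk.injEq, decide_eq_true_eq,
        decide_eq_false_iff_not] at hR hε
      ext i j; fin_cases i <;> fin_cases j <;> simp_all [cell1])]
  rw [ncard_isIdeal_cell P.rel (false, false, true, false) cell2 (fun R => R 1 2)
    (fun _ => rfl) (fun p => ⟨by simp [isReduced_basisRank_iff, cell2], by simp [pivots, cell2]⟩)
    (fun R hR hε => by
      simp only [isReduced_basisRank_iff, pivots, Prod.mk.injEq, decide_eq_true_eq,
        decide_eq_false_iff_not] at hR hε
      ext i j; fin_cases i <;> fin_cases j <;> simp_all [cell2])]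
  rw [ncard_isIdeal_cell P.rel (false, false, false, true) cell3 (fun R => ())
    (fun _ => rfl) (fun p => ⟨by simp [isReduced_basisRank_iff, cell3], by simp [pivots, cell3]⟩)
    (fun R hR hε => by
      simp only [isReduced_basisRank_iff, pivots, Prod.mk.injEq, decide_eq_true_eq,
        decide_eq_false_iff_not] at hR hε
      ext i j; fin_cases i <;> fin_cases j <;> simp_all [cell3])]
  rw [ncard_isIdeal_cell P.rel (true, true, false, false) cell41 (fun R => (R 0 1, R 0 2, R 3 1, R 3 2))
    (fun _ => rfl) (fun p => ⟨by simp [isReduced_basisRank_iff, cell41], by simp [pivots, cell41]⟩)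
    (fun R hR hε => by
      simp only [isReduced_basisRank_iff, pivots, Prod.mk.injEq, decide_eq_true_eq,
        decide_eq_false_iff_not] at hR hε
      ext i j; fin_cases i <;> fin_cases j <;> simp_all [cell41])]
  rw [ncard_isIdeal_cell P.rel (true, false, true, false) cell42 (fun R => (R 1 2, R 3 0, R 3 2))
    (fun _ => rfl) (fun p => ⟨by simp [isReduced_basisRank_iff, cell42], by simp [pivots, cell42]⟩)
    (fun R hR hε => by
      simp only [isReduced_basisRank_iff, pivots, Prod.mk.injEq, decide_eq_true_eq,
        decide_eq_false_iff_not] at hR hε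
      ext i j; fin_cases i <;> fin_cases j <;> simp_all [cell42])]
  rw [ncard_isIdeal_cell P.rel (true, false, false, true) cell43 (fun R => (R 3 0, R 3 1))
    (fun _ => rfl) (fun p => ⟨by simp [isReduced_basisRank_iff, cell43], by simp [pivots, cell43]⟩)
    (fun R hR hε => by
      simp only [isReduced_basisRank_iff, pivots, Prod.mk.injEq, decide_eq_true_eq,
        decide_eq_false_iff_not] at hR hε
      ext i j; fin_cases i <;> fin_cases j <;> simp_all [cell43])]
  rw [ncard_isIdeal_cell P.rel (false, true, true, false) cell12 (fun R => (R 0 2, R 1 2))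
    (fun _ => rfl) (fun p => ⟨by simp [isReduced_basisRank_iff, cell12], by simp [pivots, cell12]⟩)
    (fun R hR hε => by
      simp only [isReduced_basisRank_iff, pivots, Prod.mk.injEq, decide_eq_true_eq,
        decide_eq_false_iff_not] at hR hε
      ext i j; fin_cases i <;> fin_cases j <;> simp_all [cell12])]
  rw [ncard_isIdeal_cell P.rel (false, true, false, true) cell13 (fun R => R 0 1)
    (fun _ => rfl) (fun p => ⟨by simp [isReduced_basisRank_iff, cell13], by simp [pivots, cell13]⟩)
    (fun R hR hε => by
      simp only [isReduced_basisRank_iff, pivots, Prod.mk.injEq, decide_eq_true_eq,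
        decide_eq_false_iff_not] at hR hε
      ext i j; fin_cases i <;> fin_cases j <;> simp_all [cell13])]
  rw [ncard_isIdeal_cell P.rel (false, false, true, true) cell23 (fun R => ())
    (fun _ => rfl) (fun p => ⟨by simp [isReduced_basisRank_iff, cell23], by simp [pivots, cell23]⟩)
    (fun R hR hε => by
      simp only [isReduced_basisRank_iff, pivots, Prod.mk.injEq, decide_eq_true_eq,
        decide_eq_false_iff_not] at hR hε
      ext i j; fin_cases i <;> fin_cases j <;> simp_all [cell23])]
  rw [ncard_isIdeal_cell P.rel (true, true, true, false) cell412 (fun R => (R 0 2, R 1 2, R 3 2))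
    (fun _ => rfl) (fun p => ⟨by simp [isReduced_basisRank_iff, cell412], by simp [pivots, cell412]⟩)
    (fun R hR hε => by
      simp only [isReduced_basisRank_iff, pivots, Prod.mk.injEq, decide_eq_true_eq,
        decide_eq_false_iff_not] at hR hε
      ext i j; fin_cases i <;> fin_cases j <;> simp_all [cell412])]
  rw [ncard_isIdeal_cell P.rel (true, true, false, true) cell413 (fun R => (R 0 1, R 3 1))
    (fun _ => rfl) (fun p => ⟨by simp [isReduced_basisRank_iff, cell413], by simp [pivots, cell413]⟩)
    (fun R hR hε => by
      simp only [isReduced_basisRank_iff, pivots, Prod.mk.injEq, decide_eq_true_eq,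
        decide_eq_false_iff_not] at hR hε
      ext i j; fin_cases i <;> fin_cases j <;> simp_all [cell413])]
  rw [ncard_isIdeal_cell P.rel (true, false, true, true) cell423 (fun R => R 3 0)
    (fun _ => rfl) (fun p => ⟨by simp [isReduced_basisRank_iff, cell423], by simp [pivots, cell423]⟩)
    (fun R hR hε => by
      simp only [isReduced_basisRank_iff, pivots, Prod.mk.injEq, decide_eq_true_eq,
        decide_eq_false_iff_not] at hR hε
      ext i j; fin_cases i <;> fin_cases j <;> simp_all [cell423])]
  rw [ncard_isIdeal_cell P.rel (false, true, true, true) cell123 (fun R => ())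
    (fun _ => rfl) (fun p => ⟨by simp [isReduced_basisRank_iff, cell123], by simp [pivots, cell123]⟩)
    (fun R hR hε => by
      simp only [isReduced_basisRank_iff, pivots, Prod.mk.injEq, decide_eq_true_eq,
        decide_eq_false_iff_not] at hR hε
      ext i j; fin_cases i <;> fin_cases j <;> simp_all [cell123])]
  rw [ncard_isIdeal_cell P.rel (true, true, true, true) (fun _ : Unit => 1) (fun _ => ())
    (fun _ => rfl) (fun p => ⟨by simp [isReduced_basisRank_iff], by simp [pivots]⟩)
    (fun R hR hε => by
      simp only [isReduced_basisRank_iff, pivots, Prod.mk.injEq, decide_eq_true_eq] at hR hε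
      ext i j; fin_cases i <;> fin_cases j <;> simp_all)]
  rw [ncard_isIdeal_cell P.rel (false, false, false, false) (fun _ : Unit => 0) (fun _ => ())
    (fun _ => rfl) (fun p => ⟨by simp [isReduced_basisRank_iff], by simp [pivots]⟩)
    (fun R hR hε => by
      simp only [isReduced_basisRank_iff, pivots, Prod.mk.injEq, decide_eq_false_iff_not] at hR hε
      ext i j; fin_cases i <;> fin_cases j <;> simp_all)]
  simp only [isIdeal_zero, isIdeal_one, Set.ofPred_true, Set.ncard_univ, Nat.card_unique, Bool.not_true,
    Bool.not_false, Bool.toNat_true, Bool.toNat_false]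
  push_cast
  ring

end Cells
-- Extensions of an abelian or Heisenberg algebra by a derivation
section Extension

variable {F : Type u} [Field F]

/-- The structure constants of `[e_4, e_i] = ∑ k, d i k e_k` for `i ≤ 3` and `[e_3, e_1] = h e_2`. -/
def extRel (h : F) (d : Fin 3 → Fin 3 → F) : Fin 4 → Fin 4 → Fin 4 → F :=
  ![0, 0, ![![0, h, 0, 0], 0, 0, 0], ![![d 0 0, d 0 1, d 0 2, 0], ![d 1 0, d 1 1, d 1 2, 0],
    ![d 2 0, d 2 1, d 2 2, 0], 0]]

variable (h : F) (d : Fin 3 → Fin 3 → F)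

/-- The last two equations say that e_1 + p.1 e_2 + p.2 e_3 is an eigenvector of d. Bracketing it
with e_3 gives h e_2, which is not on the line unless h = 0. -/
theorem isIdeal_cell1 (p : F × F) :
    IsIdeal (extRel h d) (cell1 p) ↔ h = 0 ∧
      d 0 1 + p.1 * d 1 1 + p.2 * d 2 1 = p.1 * (d 0 0 + p.1 * d 1 0 + p.2 * d 2 0) ∧
      d 0 2 + p.1 * d 1 2 + p.2 * d 2 2 = p.2 * (d 0 0 + p.1 * d 1 0 + p.2 * d 2 0) := by
  simp [IsIdeal, Fin.forall_fin_succ, Fin.sum_univ_four, extRel, cell1, funext_iff]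
  grind

theorem isIdeal_cell2 (p : F) :
    IsIdeal (extRel h d) (cell2 p) ↔ p * h = 0 ∧ d 1 0 + p * d 2 0 = 0 ∧
      d 1 2 + p * d 2 2 = p * (d 1 1 + p * d 2 1) := by
  simp [IsIdeal, Fin.forall_fin_succ, Fin.sum_univ_four, extRel, cell2, funext_iff]
  grind

theorem isIdeal_cell3 (p : Unit) :
    IsIdeal (extRel h d) (cell3 p) ↔ h = 0 ∧ d 2 0 = 0 ∧ d 2 1 = 0 := by
  simp [IsIdeal, Fin.forall_fin_succ, Fin.sum_univ_four, extRel, cell3, funext_iff]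
  grind

theorem isIdeal_cell12 (p : F × F) :
    IsIdeal (extRel h d) (cell12 p) ↔ p.2 * h = 0 ∧
      d 0 2 + p.1 * d 2 2 = p.1 * (d 0 0 + p.1 * d 2 0) + p.2 * (d 0 1 + p.1 * d 2 1) ∧
      d 1 2 + p.2 * d 2 2 = p.1 * (d 1 0 + p.2 * d 2 0) + p.2 * (d 1 1 + p.2 * d 2 1) := by
  simp [IsIdeal, Fin.forall_fin_succ, Fin.sum_univ_four, extRel, cell12, funext_iff]
  grind

theorem isIdeal_cell13 (p : F) :
    IsIdeal (extRel h d) (cell13 p) ↔ h = 0 ∧ d 0 1 + p * d 1 1 = p * (d 0 0 + p * d 1 0) ∧ d 2 1 = p * d 2 0 := by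
  simp [IsIdeal, Fin.forall_fin_succ, Fin.sum_univ_four, extRel, cell13, funext_iff]
  grind

theorem isIdeal_cell23 (p : Unit) :
    IsIdeal (extRel h d) (cell23 p) ↔ d 1 0 = 0 ∧ d 2 0 = 0 := by
  simp [IsIdeal, Fin.forall_fin_succ, Fin.sum_univ_four, extRel, cell23, funext_iff]
  grind

theorem isIdeal_cell123 (p : Unit) :
    IsIdeal (extRel h d) (cell123 p) := by
  simp [IsIdeal, Fin.forall_fin_succ, Fin.sum_univ_four, extRel, cell123, funext_iff]

/-- Brackets lie in N, which meets this line in 0; so the spanning vector has to be central. -/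
theorem isIdeal_cell4 (p : F × F × F) :
    IsIdeal (extRel h d) (cell4 p) ↔ d 0 0 = 0 ∧ d 0 1 = - p.2.2 * h ∧ d 0 2 = 0 ∧ d 1 0 = 0 ∧ d 1 1 = 0 ∧
      d 1 2 = 0 ∧ d 2 0 = 0 ∧ d 2 1 = p.1 * h ∧ d 2 2 = 0 := by
  simp [IsIdeal, Fin.forall_fin_succ, Fin.sum_univ_four, extRel, cell4, funext_iff]
  grind

/-- With a pivot at e_4 the ideal absorbs the image of N under ad (e_4 + u), so d has to map all of
N into the ideal, not merely preserve its part in N; the same holds for the cells below. -/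
theorem isIdeal_cell41 (p : F × F × F × F) :
    IsIdeal (extRel h d) (cell41 p) ↔ h = 0 ∧ ∀ i, d i 1 = p.1 * d i 0 ∧ d i 2 = p.2.1 * d i 0 := by
  simp [IsIdeal, Fin.forall_fin_succ, Fin.sum_univ_four, extRel, cell41, funext_iff]
  grind

theorem isIdeal_cell42 (p : F × F × F) :
    IsIdeal (extRel h d) (cell42 p) ↔ p.1 * h = 0 ∧ ∀ i, d i 0 = 0 ∧ d i 2 = p.1 * d i 1 := by
  simp [IsIdeal, Fin.forall_fin_succ, Fin.sum_univ_four, extRel, cell42, funext_iff]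
  grind

theorem isIdeal_cell43 (p : F × F) :
    IsIdeal (extRel h d) (cell43 p) ↔ h = 0 ∧ ∀ i, d i 0 = 0 ∧ d i 1 = 0 := by
  simp [IsIdeal, Fin.forall_fin_succ, Fin.sum_univ_four, extRel, cell43, funext_iff]
  grind

theorem isIdeal_cell412 (p : F × F × F) :
    IsIdeal (extRel h d) (cell412 p) ↔ p.2.1 * h = 0 ∧ ∀ i, d i 2 = p.1 * d i 0 + p.2.1 * d i 1 := by
  simp [IsIdeal, Fin.forall_fin_succ, Fin.sum_univ_four, extRel, cell412, funext_iff]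
  grind

theorem isIdeal_cell413 (p : F × F) :
    IsIdeal (extRel h d) (cell413 p) ↔ h = 0 ∧ ∀ i, d i 1 = p.1 * d i 0 := by
  simp [IsIdeal, Fin.forall_fin_succ, Fin.sum_univ_four, extRel, cell413, funext_iff]
  grind

theorem isIdeal_cell423 (p : F) :
    IsIdeal (extRel h d) (cell423 p) ↔ ∀ i, d i 0 = 0 := by
  simp [IsIdeal, Fin.forall_fin_succ, Fin.sum_univ_four, extRel, cell423, funext_iff]
  grind

theorem idealZeta_eq_of_rel [Finite F] (P : Presentation F) {h : F} {d : Fin 3 → Fin 3 → F}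
    (hP : P.rel = extRel h d) (s t : ℂ) (ht : t = (Nat.card F : ℂ) ^ (-s)) :
    idealZeta F P.Alg s = 1 +
      ({p : F × F × F | p.2.1 * h = 0 ∧ ∀ i, d i 2 = p.1 * d i 0 + p.2.1 * d i 1}.ncard +
        {p : F × F | h = 0 ∧ ∀ i, d i 1 = p.1 * d i 0}.ncard +
        {_p : F | ∀ i, d i 0 = 0}.ncard + 1 : ℕ) * t +
      ({p : F × F × F × F | h = 0 ∧ ∀ i, d i 1 = p.1 * d i 0 ∧ d i 2 = p.2.1 * d i 0}.ncard +
        {p : F × F × F | p.1 * h = 0 ∧ ∀ i, d i 0 = 0 ∧ d i 2 = p.1 * d i 1}.ncard +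
        {_p : F × F | h = 0 ∧ ∀ i, d i 0 = 0 ∧ d i 1 = 0}.ncard +
        {p : F × F | p.2 * h = 0 ∧
          d 0 2 + p.1 * d 2 2 = p.1 * (d 0 0 + p.1 * d 2 0) + p.2 * (d 0 1 + p.1 * d 2 1) ∧
          d 1 2 + p.2 * d 2 2 =
            p.1 * (d 1 0 + p.2 * d 2 0) + p.2 * (d 1 1 + p.2 * d 2 1)}.ncard +
        {p : F | h = 0 ∧ d 0 1 + p * d 1 1 = p * (d 0 0 + p * d 1 0) ∧ d 2 1 = p * d 2 0}.ncard +
        {_p : Unit | d 1 0 = 0 ∧ d 2 0 = 0}.ncard : ℕ) * t ^ 2 +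
      ({p : F × F × F | d 0 0 = 0 ∧ d 0 1 = - p.2.2 * h ∧ d 0 2 = 0 ∧ d 1 0 = 0 ∧ d 1 1 = 0 ∧
          d 1 2 = 0 ∧ d 2 0 = 0 ∧ d 2 1 = p.1 * h ∧ d 2 2 = 0}.ncard +
        {p : F × F | h = 0 ∧
          d 0 1 + p.1 * d 1 1 + p.2 * d 2 1 = p.1 * (d 0 0 + p.1 * d 1 0 + p.2 * d 2 0) ∧
          d 0 2 + p.1 * d 1 2 + p.2 * d 2 2 = p.2 * (d 0 0 + p.1 * d 1 0 + p.2 * d 2 0)}.ncard +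
        {p : F | p * h = 0 ∧ d 1 0 + p * d 2 0 = 0 ∧
          d 1 2 + p * d 2 2 = p * (d 1 1 + p * d 2 1)}.ncard +
        {_p : Unit | h = 0 ∧ d 2 0 = 0 ∧ d 2 1 = 0}.ncard : ℕ) * t ^ 3 + t ^ 4 := by
  rw [idealZeta_eq_cells P s t ht, hP]
  simp only [isIdeal_cell1, isIdeal_cell2, isIdeal_cell3, isIdeal_cell12, isIdeal_cell13,
    isIdeal_cell23, isIdeal_cell123, isIdeal_cell4, isIdeal_cell41, isIdeal_cell42,
    isIdeal_cell43, isIdeal_cell412, isIdeal_cell413, isIdeal_cell423, Set.ofPred_true,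
    Set.ncard_univ, Nat.card_unique]

end Extension
-- Counting invariant subspaces for each derivation
section Counts

variable {F : Type u} [Field F]

theorem ncard_eq_of_inverse {α β : Type*} {S : Set α} {T : Set β} (f : α → β) (g : β → α)
    (hf : ∀ x ∈ S, f x ∈ T ∧ g (f x) = x) (hg : ∀ y ∈ T, g y ∈ S ∧ f (g y) = y) :
    S.ncard = T.ncard :=
  Set.ncard_congr (fun x _ => f x) (fun x hx => (hf x hx).1)
    (fun x y hx hy h => by rw [← (hf x hx).2, h, (hf y hy).2])
    fun y hy => ⟨g y, (hg y hy).1, (hg y hy).2⟩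

theorem ncard_eq_card_of_inverse {α β : Type*} {S : Set α} (f : α → β) (g : β → α)
    (hf : ∀ x ∈ S, g (f x) = x) (hg : ∀ y, g y ∈ S ∧ f (g y) = y) : S.ncard = Nat.card β := by
  rw [← Set.ncard_univ]
  exact ncard_eq_of_inverse f g (fun x hx => ⟨trivial, hf x hx⟩) fun y _ => hg y

theorem ncard_eq_one_of_iff {α : Type*} {C : α → Prop} (c : α) (h : ∀ x, C x ↔ x = c) :
    {x | C x}.ncard = 1 := by
  simp [h]

theorem ncard_eq_zero_of_not {α : Type*} {C : α → Prop} (h : ∀ x, ¬ C x) :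
    {x | C x}.ncard = 0 := by
  simp [h]

theorem vec_zero {α : Type*} [Zero α] : (![0, 0, 0, 0] : Fin 4 → α) = 0 := by
  simp

theorem M1_rel : (M1 F).rel = extRel 0 ![![0, 0, 0], ![0, 0, 0], ![0, 0, 0]] := by
  simp [M1, extRel, vec_zero]

theorem M2_rel : (M2 F).rel = extRel 0 ![![1, 0, 0], ![0, 1, 0], ![0, 0, 1]] := by
  simp [M2, extRel, vec_zero]

theorem M3_rel (a : F) : (M3 a).rel = extRel 0 ![![1, 0, 0], ![0, 0, 1], ![0, -a, a + 1]] := by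
  simp [M3, extRel, vec_zero]

theorem M4_rel : (M4 F).rel = extRel 0 ![![0, 0, 0], ![0, 0, 1], ![0, 0, 1]] := by
  simp [M4, extRel, vec_zero]

theorem M5_rel : (M5 F).rel = extRel 0 ![![0, 0, 0], ![0, 0, 1], ![0, 0, 0]] := by
  simp [M5, extRel, vec_zero]

theorem M6_rel (a b : F) : (M6 a b).rel = extRel 0 ![![0, 1, 0], ![0, 0, 1], ![a, b, 1]] := by
  simp [M6, extRel, vec_zero]

theorem M7_rel (a b : F) : (M7 a b).rel = extRel 0 ![![0, 1, 0], ![0, 0, 1], ![-a, b, 0]] := by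
  simp [M7, extRel, vec_zero]

theorem M12_rel : (M12 F).rel = extRel 1 ![![1, 0, 0], ![0, 2, 0], ![0, 0, 1]] := by
  simp [M12, extRel]

theorem M13_rel (a : F) : (M13 a).rel = extRel 1 ![![1, 0, a], ![0, 1, 0], ![1, 0, 0]] := by
  simp [M13, extRel]

theorem M14_rel (a : F) : (M14 a).rel = extRel 1 ![![0, 0, a], ![0, 0, 0], ![1, 0, 0]] := by
  simp [M14, extRel, vec_zero]

theorem V3_zero : V3 (0 : F) = 1 := ncard_eq_one_of_iff (-1) (by grind)

theorem V4_zero : V4 (0 : F) = 0 := ncard_eq_zero_of_not (by grind)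

variable [Finite F]

theorem idealZeta_M1 {s t : ℂ} (ht : t = (Nat.card F : ℂ) ^ (-s)) :
    idealZeta F (M1 F).Alg s =
      1 + (1 + Nat.card F + Nat.card F ^ 2 + Nat.card F ^ 3) * t
        + (1 + Nat.card F + Nat.card F ^ 2) * (1 + Nat.card F ^ 2) * t ^ 2
        + (1 + Nat.card F + Nat.card F ^ 2 + Nat.card F ^ 3) * t ^ 3 + t ^ 4 := by
  rw [idealZeta_eq_of_rel _ M1_rel s t ht]
  simp [Fin.forall_fin_succ, Set.ncard_univ, Nat.card_prod]
  ring

theorem idealZeta_M2 {s t : ℂ} (ht : t = (Nat.card F : ℂ) ^ (-s)) :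
    idealZeta F (M2 F).Alg s =
      1 + t + (1 + Nat.card F + Nat.card F ^ 2) * t ^ 2
        + (1 + Nat.card F + Nat.card F ^ 2) * t ^ 3 + t ^ 4 := by
  rw [idealZeta_eq_of_rel _ M2_rel s t ht]
  simp [Fin.forall_fin_succ, Set.ncard_univ, Nat.card_prod]
  ring

/-- On ⟨e_2, e_3⟩ the characteristic polynomial is (x - 1)(x - a), so d is diagonalizable with a
plane of eigenvalue 1 and a line of eigenvalue a. -/
theorem idealZeta_M3 {s t : ℂ} (ht : t = (Nat.card F : ℂ) ^ (-s)) {a : F} (ha0 : a ≠ 0)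
    (ha1 : a ≠ 1) :
    idealZeta F (M3 a).Alg s =
      1 + t + (2 + Nat.card F) * t ^ 2 + (2 + Nat.card F) * t ^ 3 + t ^ 4 := by
  -- The second equation factors as (p.2 + 1)(a p.2 + 1) = 0. The root -1 leaves `p.1` free; the
  -- root `-a⁻¹` forces `p.1 = 0` and is the extra point `none`. The sets are written as
  -- simplification leaves them.
  have h1 : {p : F × F | p.1 * (a + 1) = p.1 + -(p.2 * (p.1 * a)) ∧
      1 + p.2 * (a + 1) = -(p.2 * (p.2 * a))}.ncard = Nat.card F + 1 := by
    rw [← Finite.card_option]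
    exact ncard_eq_card_of_inverse
      (open Classical in fun p => if p.2 = -1 then some p.1 else none)
      (fun o => o.elim (0, -a⁻¹) fun x => (x, -1)) (by grind) (by rintro (_ | x) <;> grind)
  have h2 : {p : F × F | -(p.2 * a) = p.1 ∧ p.1 + p.2 * (a + 1) = p.2}.ncard = Nat.card F :=
    ncard_eq_card_of_inverse Prod.snd (fun x => (-(x * a), x)) (by grind) (by grind)
  have h3 : {p : F | 1 + p * (a + 1) = -(p * (p * a))}.ncard = 2 := by
    rw [← Set.ncard_pair (a := -1) (b := -a⁻¹) (by grind)]
    congr 1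
    ext x
    simp only [Set.mem_ofPred_eq, Set.mem_insert_iff, Set.mem_singleton_iff]
    grind
  rw [idealZeta_eq_of_rel _ (M3_rel a) s t ht]
  simp [Fin.forall_fin_succ, h1, h2, h3, ha0]
  ring

theorem idealZeta_M3_one {s t : ℂ} (ht : t = (Nat.card F : ℂ) ^ (-s)) :
    idealZeta F (M3 (1 : F)).Alg s =
      1 + t + (1 + Nat.card F) * t ^ 2 + (1 + Nat.card F) * t ^ 3 + t ^ 4 := by
  have h1 : {p : F × F | p.1 * (1 + 1) = p.1 + -(p.2 * p.1) ∧
      1 + p.2 * (1 + 1) = -(p.2 * p.2)}.ncard = Nat.card F :=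
    ncard_eq_card_of_inverse Prod.fst (fun x => (x, -1))
      (fun p hp => by
        have h : (p.2 + 1) ^ 2 = 0 := by linear_combination hp.2
        exact Prod.ext rfl (eq_neg_of_add_eq_zero_left (pow_eq_zero_iff two_ne_zero |>.1 h)).symm)
      (by grind)
  have h2 : {p : F × F | -p.2 = p.1 ∧ p.1 + p.2 * (1 + 1) = p.2}.ncard = Nat.card F :=
    ncard_eq_card_of_inverse Prod.snd (fun x => (-x, x)) (by grind) (by grind)
  have h3 : {p : F | 1 + p * (1 + 1) = -(p * p)}.ncard = 1 :=
    ncard_eq_one_of_iff (-1) (by grind)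
  rw [idealZeta_eq_of_rel _ (M3_rel 1) s t ht]
  simp [Fin.forall_fin_succ, h1, h2, h3]
  ring

theorem idealZeta_M3_zero {s t : ℂ} (ht : t = (Nat.card F : ℂ) ^ (-s)) :
    idealZeta F (M3 (0 : F)).Alg s =
      1 + (1 + Nat.card F) * t + (2 + Nat.card F) * t ^ 2 + (2 + Nat.card F) * t ^ 3 + t ^ 4 := by
  have h0 : {p : F × F | 0 = p.1}.ncard = Nat.card F :=
    ncard_eq_card_of_inverse Prod.snd (fun x => (0, x)) (by grind) (by grind)
  have h1 : {p : F × F | 1 + p.2 = 0}.ncard = Nat.card F :=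
    ncard_eq_card_of_inverse Prod.fst (fun x => (x, -1)) (by grind) (by grind)
  have h2 : {p : F × F | 0 = p.1 ∧ p.1 = 0}.ncard = Nat.card F :=
    ncard_eq_card_of_inverse Prod.snd (fun x => (0, x)) (by grind) (by grind)
  have h3 : {p : F | 1 + p = 0}.ncard = 1 := ncard_eq_one_of_iff (-1) (by grind)
  rw [idealZeta_eq_of_rel _ (M3_rel 0) s t ht]
  simp [Fin.forall_fin_succ, h0, h1, h2, h3]
  ring

/-- Here d is a projection of rank one onto ⟨e_3⟩: the invariant lines are ⟨e_3⟩ and those in the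
kernel, the invariant planes are the kernel and those containing e_3. -/
theorem idealZeta_M4 {s t : ℂ} (ht : t = (Nat.card F : ℂ) ^ (-s)) :
    idealZeta F (M4 F).Alg s =
      1 + (1 + Nat.card F + Nat.card F ^ 2) * t + (2 + Nat.card F + Nat.card F ^ 2) * t ^ 2
        + (2 + Nat.card F) * t ^ 3 + t ^ 4 := by
  have h1 : {p : F × F | p.1 = 0 ∧ 1 + p.2 = 0}.ncard = 1 :=
    ncard_eq_one_of_iff (0, -1) (by grind)
  have h2 : {p : F × F | p.1 + p.2 = 0}.ncard = Nat.card F :=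
    ncard_eq_card_of_inverse Prod.snd (fun x => (-x, x)) (by grind) (by grind)
  have h3 : {p : F | 1 + p = 0}.ncard = 1 := ncard_eq_one_of_iff (-1) (by grind)
  rw [idealZeta_eq_of_rel _ M4_rel s t ht]
  simp [Fin.forall_fin_succ, Set.ncard_univ, Nat.card_prod, h1, h2, h3]
  ring

theorem idealZeta_M5 {s t : ℂ} (ht : t = (Nat.card F : ℂ) ^ (-s)) :
    idealZeta F (M5 F).Alg s =
      1 + (1 + Nat.card F + Nat.card F ^ 2) * t + (1 + Nat.card F + Nat.card F ^ 2) * t ^ 2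
        + (1 + Nat.card F) * t ^ 3 + t ^ 4 := by
  have h1 : {p : F × F | p.1 = 0}.ncard = Nat.card F :=
    ncard_eq_card_of_inverse Prod.snd (fun x => (0, x)) (by grind) (by grind)
  rw [idealZeta_eq_of_rel _ M5_rel s t ht]
  simp [Fin.forall_fin_succ, Set.ncard_univ, Nat.card_prod, h1]
  ring

/-- Here d is cyclic with characteristic polynomial λ³ - λ² - bλ - a, so every eigenvalue has
exactly one invariant line and one invariant plane. Eigenvalues are nonzero as a ≠ 0; the planes
have x = -1/λ and the lines x = λ/a. -/
theorem idealZeta_M6 {s t : ℂ} (ht : t = (Nat.card F : ℂ) ^ (-s)) {a : F} (ha : a ≠ 0) (b : F) :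
    idealZeta F (M6 a b).Alg s = 1 + t + V6two a b * t ^ 2 + V6one a b * t ^ 3 + t ^ 4 := by
  have h1 : {p : F × F | p.1 = p.1 * (p.1 * a) + p.2 * (1 + p.1 * b) ∧
      1 + p.2 = p.1 * (p.2 * a) + p.2 * (p.2 * b)}.ncard = V6two a b :=
    ncard_eq_of_inverse Prod.snd (fun x => (-x ^ 2, x)) (by grind) (by grind)
  have h2 : {p : F × F | 1 + p.2 * b = p.1 * (p.2 * a) ∧ p.1 + p.2 = p.2 * (p.2 * a)}.ncard =
      V6one a b :=
    ncard_eq_of_inverse Prod.snd (fun x => (a * x ^ 2 - x, x)) (by grind) (by grind)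
  have h3 : {p : F | p = 0 ∧ 1 + p = p * (p * b)}.ncard = 0 :=
    ncard_eq_zero_of_not (by grind)
  rw [idealZeta_eq_of_rel _ (M6_rel a b) s t ht]
  simp [Fin.forall_fin_succ, h1, h2, h3, ha]

theorem idealZeta_M6_zero {s t : ℂ} (ht : t = (Nat.card F : ℂ) ^ (-s)) (b : F) :
    idealZeta F (M6 0 b).Alg s =
      1 + (1 + Nat.card F) * t + (1 + V3 b) * t ^ 2 + (1 + V3 b) * t ^ 3 + t ^ 4 := by
  have h1 : {p : F × F | p.1 = p.2 * (1 + p.1 * b) ∧ 1 + p.2 = p.2 * (p.2 * b)}.ncard = V3 b :=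
    ncard_eq_of_inverse Prod.snd (fun x => (-x ^ 2, x)) (by grind) (by grind)
  have h2 : {p : F | 1 + p = p * (p * b)}.ncard = V3 b :=
    ncard_eq_of_inverse id id (by grind) (by grind)
  -- One invariant line remains outside the cell with pivot e_2: the kernel of d, with pivot e_1, if
  -- b ≠ 0, and ⟨e_3⟩ if b = 0.
  have h3 : {p : F × F | 1 + p.2 * b = 0 ∧ p.1 + p.2 = 0}.ncard + {_p : Unit | b = 0}.ncard =
      1 := by
    by_cases hb : b = 0
    · simp [hb]
    · rw [ncard_eq_one_of_iff (b⁻¹, -b⁻¹) (by grind)]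
      simp [hb]
  rw [idealZeta_eq_of_rel _ (M6_rel 0 b) s t ht]
  have h3' := congrArg (Nat.cast : ℕ → ℂ) h3
  push_cast at h3'
  simp [Fin.forall_fin_succ, Set.ncard_univ, h1, h2]
  linear_combination t ^ 3 * h3'

theorem idealZeta_M7 {s t : ℂ} (ht : t = (Nat.card F : ℂ) ^ (-s)) {a : F} (ha : a ≠ 0) (b : F) :
    idealZeta F (M7 a b).Alg s = 1 + t + V7two a b * t ^ 2 + V7one a b * t ^ 3 + t ^ 4 := by
  have h1 : {p : F × F | 0 = -(p.1 * (p.1 * a)) + p.2 * (1 + p.1 * b) ∧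
      1 = -(p.1 * (p.2 * a)) + p.2 * (p.2 * b)}.ncard = V7two a b :=
    -- An invariant plane with eigenvalue λ has `p.2 = -1/λ`, whereas the roots counted by `V7two`
    -- are 1/λ; hence the sign.
    ncard_eq_of_inverse (fun p => -p.2) (fun x => (-x ^ 2, -x)) (by grind) (by grind)
  have h2 : {p : F × F | 1 + p.2 * b = -(p.1 * (p.2 * a)) ∧ p.1 = -(p.2 * (p.2 * a))}.ncard =
      V7one a b :=
    ncard_eq_of_inverse Prod.snd (fun x => (-(a * x ^ 2), x)) (by grind) (by grind)
  have h3 : {p : F | p = 0 ∧ 1 = p * (p * b)}.ncard = 0 :=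
    ncard_eq_zero_of_not (by grind)
  rw [idealZeta_eq_of_rel _ (M7_rel a b) s t ht]
  simp [Fin.forall_fin_succ, h1, h2, h3, ha]

theorem idealZeta_M7_zero {s t : ℂ} (ht : t = (Nat.card F : ℂ) ^ (-s)) (b : F) :
    idealZeta F (M7 0 b).Alg s =
      1 + (1 + Nat.card F) * t + (1 + V4 b) * t ^ 2 + (1 + V4 b) * t ^ 3 + t ^ 4 := by
  have h1 : {p : F × F | (p.2 = 0 ∨ 1 + p.1 * b = 0) ∧ 1 = p.2 * (p.2 * b)}.ncard = V4 b :=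
    ncard_eq_of_inverse Prod.snd (fun x => (-x ^ 2, x)) (by grind) (by grind)
  have h2 : {p : F | 1 = p * (p * b)}.ncard = V4 b :=
    ncard_eq_of_inverse id id (by grind) (by grind)
  have h3 : {p : F × F | 1 + p.2 * b = 0 ∧ p.1 = 0}.ncard + {_p : Unit | b = 0}.ncard = 1 := by
    by_cases hb : b = 0
    · simp [hb]
    · rw [ncard_eq_one_of_iff (0, -b⁻¹) (by grind)]
      simp [hb]
  rw [idealZeta_eq_of_rel _ (M7_rel 0 b) s t ht]
  have h3' := congrArg (Nat.cast : ℕ → ℂ) h3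
  push_cast at h3'
  simp [Fin.forall_fin_succ, Set.ncard_univ, h1, h2]
  linear_combination t ^ 3 * h3'

theorem idealZeta_M12 {s t : ℂ} (ht : t = (Nat.card F : ℂ) ^ (-s)) :
    idealZeta F (M12 F).Alg s = 1 + t + (1 + Nat.card F) * t ^ 2 + t ^ 3 + t ^ 4 := by
  have h1 : {p : F × F | p.2 = 0 ∧ p.2 = p.2 * 2}.ncard = Nat.card F :=
    ncard_eq_card_of_inverse Prod.fst (fun x => (x, 0)) (by grind) (by grind)
  have h2 : {p : F | p = 0 ∧ p = p * 2}.ncard = 1 := ncard_eq_one_of_iff 0 (by grind)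
  rw [idealZeta_eq_of_rel _ M12_rel s t ht]
  simp [Fin.forall_fin_succ, h1, h2]
  exact Or.inl (add_comm _ _)

/-- A plane ideal of N contains the centre e_2, so these planes are eigenlines of d on N/⟨e_2⟩.
There the line of e_1 + x e_3 has eigenvalue 1 + x, and a = x(1 + x). -/
theorem idealZeta_M13 {s t : ℂ} (ht : t = (Nat.card F : ℂ) ^ (-s)) {a : F} (ha : a ≠ 0) :
    idealZeta F (M13 a).Alg s = 1 + t + V13 a * t ^ 2 + t ^ 3 + t ^ 4 := by
  have h0 : {p : F × F × F | p.2.1 = 0 ∧ a = p.1 ∧ 0 = p.2.1 ∧ 0 = p.1}.ncard = 0 :=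
    ncard_eq_zero_of_not (by grind)
  have h1 : {p : F × F | p.2 = 0 ∧ a = p.1 * (1 + p.1) ∧ 0 = p.1 * p.2 + p.2}.ncard = V13 a :=
    ncard_eq_of_inverse Prod.fst (fun x => (x, 0)) (by grind) (by grind)
  have h2 : {p : F | p = 0 ∧ 0 = p}.ncard = 1 := ncard_eq_one_of_iff 0 (by grind)
  rw [idealZeta_eq_of_rel _ (M13_rel a) s t ht]
  simp [Fin.forall_fin_succ, h0, h1, h2]

/-- At a = 0 the image of d shrinks to ⟨e_1, e_2⟩, which produces `q` further hyperplane ideals; the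
roots 0 and -1 are distinct in every characteristic. -/
theorem idealZeta_M13_zero {s t : ℂ} (ht : t = (Nat.card F : ℂ) ^ (-s)) :
    idealZeta F (M13 (0 : F)).Alg s = 1 + (1 + Nat.card F) * t + 2 * t ^ 2 + t ^ 3 + t ^ 4 := by
  have h0 : {p : F × F × F | p.2.1 = 0 ∧ 0 = p.1 ∧ 0 = p.2.1 ∧ 0 = p.1}.ncard = Nat.card F :=
    ncard_eq_card_of_inverse (fun p => p.2.2) (fun x => (0, 0, x)) (by grind) (by grind)
  have h1 : {p : F × F | p.2 = 0 ∧ (p.1 = 0 ∨ 1 + p.1 = 0) ∧ 0 = p.1 * p.2 + p.2}.ncard = 2 := by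
    rw [← Set.ncard_pair (a := ((0, 0) : F × F)) (b := (-1, 0)) (by grind)]
    congr 1
    ext x
    simp only [Set.mem_ofPred_eq, Set.mem_insert_iff, Set.mem_singleton_iff]
    grind
  have h2 : {p : F | p = 0 ∧ 0 = p}.ncard = 1 := ncard_eq_one_of_iff 0 (by grind)
  rw [idealZeta_eq_of_rel _ (M13_rel 0) s t ht]
  simp [Fin.forall_fin_succ, h0, h1, h2]
  exact Or.inl (add_comm _ _)

theorem idealZeta_M14 {s t : ℂ} (ht : t = (Nat.card F : ℂ) ^ (-s)) {a : F} (ha : a ≠ 0) :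
    idealZeta F (M14 a).Alg s = 1 + t + V14 a * t ^ 2 + t ^ 3 + t ^ 4 := by
  have h1 : {p : F × F | p.2 = 0 ∧ a = p.1 * p.1 ∧ (p.1 = 0 ∨ p.2 = 0)}.ncard = V14 a :=
    ncard_eq_of_inverse Prod.fst (fun x => (x, 0)) (by grind) (by grind)
  rw [idealZeta_eq_of_rel _ (M14_rel a) s t ht]
  simp [Fin.forall_fin_succ, h1, ha]

end Counts
-- The two algebras outside the extension family
section Exceptional

variable {F : Type u} [Field F]

theorem M8_cell4 (p : F × F × F) : IsIdeal (M8 F).rel (cell4 p) ↔ p = 0 := by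
  simp [IsIdeal, Fin.forall_fin_succ, Fin.sum_univ_four, M8, cell4, funext_iff, Prod.ext_iff]
  grind

theorem M8_cell1 (p : F × F) : ¬ IsIdeal (M8 F).rel (cell1 p) := by
  simp [IsIdeal, Fin.forall_fin_succ, Fin.sum_univ_four, M8, cell1, funext_iff]

theorem M8_cell2 (p : F) : IsIdeal (M8 F).rel (cell2 p) ↔ p = 0 := by
  simp [IsIdeal, Fin.forall_fin_succ, Fin.sum_univ_four, M8, cell2, funext_iff]

theorem M8_cell3 (p : Unit) : ¬ IsIdeal (M8 F).rel (cell3 p) := by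
  simp [IsIdeal, Fin.forall_fin_succ, Fin.sum_univ_four, M8, cell3, funext_iff]

theorem M8_cell41 (p : F × F × F × F) : ¬ IsIdeal (M8 F).rel (cell41 p) := by
  simp [IsIdeal, Fin.forall_fin_succ, Fin.sum_univ_four, M8, cell41, funext_iff]

theorem M8_cell42 (p : F × F × F) : IsIdeal (M8 F).rel (cell42 p) ↔ p = 0 := by
  simp [IsIdeal, Fin.forall_fin_succ, Fin.sum_univ_four, M8, cell42, funext_iff, Prod.ext_iff]
  grind

theorem M8_cell43 (p : F × F) : IsIdeal (M8 F).rel (cell43 p) ↔ p = 0 := by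
  simp [IsIdeal, Fin.forall_fin_succ, Fin.sum_univ_four, M8, cell43, funext_iff, Prod.ext_iff]
  grind

theorem M8_cell12 (p : F × F) : IsIdeal (M8 F).rel (cell12 p) ↔ p = 0 := by
  simp [IsIdeal, Fin.forall_fin_succ, Fin.sum_univ_four, M8, cell12, funext_iff, Prod.ext_iff]
  grind

theorem M8_cell13 (p : F) : ¬ IsIdeal (M8 F).rel (cell13 p) := by
  simp [IsIdeal, Fin.forall_fin_succ, Fin.sum_univ_four, M8, cell13, funext_iff]

theorem M8_cell23 (p : Unit) : ¬ IsIdeal (M8 F).rel (cell23 p) := by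
  simp [IsIdeal, Fin.forall_fin_succ, Fin.sum_univ_four, M8, cell23, funext_iff]

theorem M8_cell412 (p : F × F × F) : IsIdeal (M8 F).rel (cell412 p) ↔ p.2 = 0 := by
  simp [IsIdeal, Fin.forall_fin_succ, Fin.sum_univ_four, M8, cell412, funext_iff, Prod.ext_iff]
  grind

theorem M8_cell413 (p : F × F) : ¬ IsIdeal (M8 F).rel (cell413 p) := by
  simp [IsIdeal, Fin.forall_fin_succ, Fin.sum_univ_four, M8, cell413, funext_iff]

theorem M8_cell423 (p : F) : IsIdeal (M8 F).rel (cell423 p) ↔ p = 0 := by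
  simp [IsIdeal, Fin.forall_fin_succ, Fin.sum_univ_four, M8, cell423, funext_iff]

theorem M8_cell123 (p : Unit) : ¬ IsIdeal (M8 F).rel (cell123 p) := by
  simp [IsIdeal, Fin.forall_fin_succ, Fin.sum_univ_four, M8, cell123, funext_iff]

theorem M9_cell4 (a : F) (p : F × F × F) : ¬ IsIdeal (M9 a).rel (cell4 p) := by
  simp [IsIdeal, Fin.forall_fin_succ, Fin.sum_univ_four, M9, cell4, funext_iff]

theorem M9_cell1 {a : F} (ha : ∀ x : F, x ^ 2 - x - a ≠ 0) (p : F × F) :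
    ¬ IsIdeal (M9 a).rel (cell1 p) := by
  simp [IsIdeal, Fin.forall_fin_succ, Fin.sum_univ_four, M9, cell1, funext_iff]
  -- An e_4-stable line through e_1 + p.1 e_2 would give p.1² + p.1 = a, so -p.1 would be a root of
  -- x² - x - a.
  have := ha (-p.1)
  grind

theorem M9_cell2 (a : F) (p : F) : ¬ IsIdeal (M9 a).rel (cell2 p) := by
  simp [IsIdeal, Fin.forall_fin_succ, Fin.sum_univ_four, M9, cell2, funext_iff]

theorem M9_cell3 (a : F) (p : Unit) : ¬ IsIdeal (M9 a).rel (cell3 p) := by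
  simp [IsIdeal, Fin.forall_fin_succ, Fin.sum_univ_four, M9, cell3, funext_iff]

theorem M9_cell41 {a : F} (ha : ∀ x : F, x ^ 2 - x - a ≠ 0) (p : F × F × F × F) :
    ¬ IsIdeal (M9 a).rel (cell41 p) := by
  simp [IsIdeal, Fin.forall_fin_succ, Fin.sum_univ_four, M9, cell41, funext_iff]
  have := ha (-p.1)
  grind

theorem M9_cell42 (a : F) (p : F × F × F) : ¬ IsIdeal (M9 a).rel (cell42 p) := by
  simp [IsIdeal, Fin.forall_fin_succ, Fin.sum_univ_four, M9, cell42, funext_iff]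

theorem M9_cell43 (a : F) (p : F × F) : ¬ IsIdeal (M9 a).rel (cell43 p) := by
  simp [IsIdeal, Fin.forall_fin_succ, Fin.sum_univ_four, M9, cell43, funext_iff]

theorem M9_cell12 (a : F) (p : F × F) : IsIdeal (M9 a).rel (cell12 p) ↔ p = 0 := by
  simp [IsIdeal, Fin.forall_fin_succ, Fin.sum_univ_four, M9, cell12, funext_iff, Prod.ext_iff]
  grind

theorem M9_cell13 (a : F) (p : F) : ¬ IsIdeal (M9 a).rel (cell13 p) := by
  simp [IsIdeal, Fin.forall_fin_succ, Fin.sum_univ_four, M9, cell13, funext_iff]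

theorem M9_cell23 (a : F) (p : Unit) : ¬ IsIdeal (M9 a).rel (cell23 p) := by
  simp [IsIdeal, Fin.forall_fin_succ, Fin.sum_univ_four, M9, cell23, funext_iff]

theorem M9_cell412 (a : F) (p : F × F × F) :
    IsIdeal (M9 a).rel (cell412 p) ↔ p.1 = 0 ∧ p.2.1 = 0 := by
  simp [IsIdeal, Fin.forall_fin_succ, Fin.sum_univ_four, M9, cell412, funext_iff]
  grind

theorem M9_cell413 (a : F) (p : F × F) : ¬ IsIdeal (M9 a).rel (cell413 p) := by
  simp [IsIdeal, Fin.forall_fin_succ, Fin.sum_univ_four, M9, cell413, funext_iff]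

theorem M9_cell423 (a : F) (p : F) : ¬ IsIdeal (M9 a).rel (cell423 p) := by
  simp [IsIdeal, Fin.forall_fin_succ, Fin.sum_univ_four, M9, cell423, funext_iff]

theorem M9_cell123 (a : F) (p : Unit) : IsIdeal (M9 a).rel (cell123 p) := by
  simp [IsIdeal, Fin.forall_fin_succ, Fin.sum_univ_four, M9, cell123, funext_iff]

variable [Finite F]

theorem idealZeta_M8 {s t : ℂ} (ht : t = (Nat.card F : ℂ) ^ (-s)) :
    idealZeta F (M8 F).Alg s = 1 + (1 + Nat.card F) * t + 3 * t ^ 2 + 2 * t ^ 3 + t ^ 4 := by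
  have h : {p : F × F × F | p.2 = 0}.ncard = Nat.card F :=
    ncard_eq_card_of_inverse Prod.fst (fun x => (x, 0)) (by grind) (by grind)
  rw [idealZeta_eq_cells _ s t ht]
  simp only [M8_cell1, M8_cell2, M8_cell3, M8_cell4, M8_cell12, M8_cell13, M8_cell23, M8_cell41,
    M8_cell42, M8_cell43, M8_cell123, M8_cell412, M8_cell413, M8_cell423, h, Set.ofPred_false,
    Set.ncard_empty, Set.ofPred_eq_eq_singleton, Set.ncard_singleton]
  push_cast
  ring

theorem idealZeta_M9 {s t : ℂ} (ht : t = (Nat.card F : ℂ) ^ (-s)) {a : F}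
    (ha : ∀ x : F, x ^ 2 - x - a ≠ 0) :
    idealZeta F (M9 a).Alg s = 1 + (1 + Nat.card F) * t + t ^ 2 + t ^ 4 := by
  have h : {p : F × F × F | p.1 = 0 ∧ p.2.1 = 0}.ncard = Nat.card F :=
    ncard_eq_card_of_inverse (fun p => p.2.2) (fun x => (0, 0, x)) (by grind) (by grind)
  rw [idealZeta_eq_cells _ s t ht]
  simp only [M9_cell1 ha, M9_cell2, M9_cell3, M9_cell4, M9_cell12, M9_cell13,
    M9_cell23, M9_cell41 ha, M9_cell42, M9_cell43, M9_cell123, M9_cell412,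
    M9_cell413, M9_cell423, h, Set.ofPred_false, Set.ofPred_true, Set.ncard_univ,
    Nat.card_unique, Set.ncard_empty, Set.ofPred_eq_eq_singleton, Set.ncard_singleton]
  push_cast
  ring

end Exceptional
end SolvableLie

/-! ### Assembly of the theorem -/

open SolvableLie in
theorem mainTheorem2 {F : Type*} [Field F] [Finite F] (q : ℕ) (hq : q = Nat.card F)
    (s t : ℂ) (ht : t = (q : ℂ) ^ (-s)) :
    SolvableLie.idealZeta F (SolvableLie.M1 F).Alg s =
      1 + (1 + q + q ^ 2 + q ^ 3) * t + (1 + q + q ^ 2) * (1 + q ^ 2) * t ^ 2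
        + (1 + q + q ^ 2 + q ^ 3) * t ^ 3 + t ^ 4 ∧
    SolvableLie.idealZeta F (SolvableLie.M2 F).Alg s =
      1 + t + (1 + q + q ^ 2) * t ^ 2 + (1 + q + q ^ 2) * t ^ 3 + t ^ 4 ∧
    (∀ a : F, a ≠ 0 → a ≠ 1 →
      SolvableLie.idealZeta F (SolvableLie.M3 a).Alg s =
        1 + t + (2 + q) * t ^ 2 + (2 + q) * t ^ 3 + t ^ 4) ∧
    SolvableLie.idealZeta F (SolvableLie.M3 (1 : F)).Alg s =
      1 + t + (1 + q) * t ^ 2 + (1 + q) * t ^ 3 + t ^ 4 ∧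
    SolvableLie.idealZeta F (SolvableLie.M3 (0 : F)).Alg s =
      1 + (1 + q) * t + (2 + q) * t ^ 2 + (2 + q) * t ^ 3 + t ^ 4 ∧
    SolvableLie.idealZeta F (SolvableLie.M4 F).Alg s =
      1 + (1 + q + q ^ 2) * t + (2 + q + q ^ 2) * t ^ 2 + (2 + q) * t ^ 3 + t ^ 4 ∧
    SolvableLie.idealZeta F (SolvableLie.M5 F).Alg s =
      1 + (1 + q + q ^ 2) * t + (1 + q + q ^ 2) * t ^ 2 + (1 + q) * t ^ 3 + t ^ 4 ∧
    (∀ a b : F, a ≠ 0 → b ≠ 0 →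
      SolvableLie.idealZeta F (SolvableLie.M6 a b).Alg s =
        1 + t + SolvableLie.V6two a b * t ^ 2 + SolvableLie.V6one a b * t ^ 3 + t ^ 4) ∧
    (∀ a : F, a ≠ 0 →
      SolvableLie.idealZeta F (SolvableLie.M6 a 0).Alg s =
        1 + t + SolvableLie.V6two a 0 * t ^ 2 + SolvableLie.V6one a 0 * t ^ 3 + t ^ 4) ∧
    (∀ b : F, b ≠ 0 →
      SolvableLie.idealZeta F (SolvableLie.M6 0 b).Alg s =
        1 + (1 + q) * t + (1 + SolvableLie.V3 b) * t ^ 2 + (1 + SolvableLie.V3 b) * t ^ 3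
          + t ^ 4) ∧
    SolvableLie.idealZeta F (SolvableLie.M6 (0 : F) 0).Alg s =
      1 + (1 + q) * t + 2 * t ^ 2 + 2 * t ^ 3 + t ^ 4 ∧
    (∀ a b : F, a ≠ 0 → b ≠ 0 →
      SolvableLie.idealZeta F (SolvableLie.M7 a b).Alg s =
        1 + t + SolvableLie.V7two a b * t ^ 2 + SolvableLie.V7one a b * t ^ 3 + t ^ 4) ∧
    (∀ a : F, a ≠ 0 →
      SolvableLie.idealZeta F (SolvableLie.M7 a 0).Alg s =
        1 + t + SolvableLie.V7two a 0 * t ^ 2 + SolvableLie.V7one a 0 * t ^ 3 + t ^ 4) ∧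
    (∀ b : F, b ≠ 0 →
      SolvableLie.idealZeta F (SolvableLie.M7 0 b).Alg s =
        1 + (1 + q) * t + (1 + SolvableLie.V4 b) * t ^ 2 + (1 + SolvableLie.V4 b) * t ^ 3
          + t ^ 4) ∧
    SolvableLie.idealZeta F (SolvableLie.M7 (0 : F) 0).Alg s =
      1 + (1 + q) * t + t ^ 2 + t ^ 3 + t ^ 4 ∧
    SolvableLie.idealZeta F (SolvableLie.M8 F).Alg s =
      1 + (1 + q) * t + 3 * t ^ 2 + 2 * t ^ 3 + t ^ 4 ∧
    (∀ a : F, (∀ x : F, x ^ 2 - x - a ≠ 0) →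
      SolvableLie.idealZeta F (SolvableLie.M9 a).Alg s = 1 + (1 + q) * t + t ^ 2 + t ^ 4) ∧
    SolvableLie.idealZeta F (SolvableLie.M12 F).Alg s =
      1 + t + (1 + q) * t ^ 2 + t ^ 3 + t ^ 4 ∧
    (∀ a : F, a ≠ 0 →
      SolvableLie.idealZeta F (SolvableLie.M13 a).Alg s =
        1 + t + SolvableLie.V13 a * t ^ 2 + t ^ 3 + t ^ 4) ∧
    SolvableLie.idealZeta F (SolvableLie.M13 (0 : F)).Alg s =
      1 + (1 + q) * t + 2 * t ^ 2 + t ^ 3 + t ^ 4 ∧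
    (∀ a : F, a ≠ 0 →
      SolvableLie.idealZeta F (SolvableLie.M14 a).Alg s =
        1 + t + SolvableLie.V14 a * t ^ 2 + t ^ 3 + t ^ 4) := by
  subst hq
  -- The formulas for a = 0 hold for every b; at b = 0 the root counts are 1 and 0, which gives the
  -- two separate entries of the table.
  have h6 := idealZeta_M6_zero ht (0 : F)
  have h7 := idealZeta_M7_zero ht (0 : F)
  rw [V3_zero] at h6
  rw [V4_zero] at h7
  refine ⟨idealZeta_M1 ht, idealZeta_M2 ht, fun a => idealZeta_M3 ht, idealZeta_M3_one ht,
    idealZeta_M3_zero ht, idealZeta_M4 ht, idealZeta_M5 ht, fun a b ha _ => idealZeta_M6 ht ha b,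
    fun a ha => idealZeta_M6 ht ha 0, fun b _ => idealZeta_M6_zero ht b, ?_,
    fun a b ha _ => idealZeta_M7 ht ha b, fun a ha => idealZeta_M7 ht ha 0,
    fun b _ => idealZeta_M7_zero ht b, ?_, idealZeta_M8 ht, fun a => idealZeta_M9 ht,
    idealZeta_M12 ht, fun a => idealZeta_M13 ht, idealZeta_M13_zero ht,
    fun a => idealZeta_M14 ht⟩
  · rw [h6]
    push_cast
    ring
  · rw [h7]
    push_cast
    ring
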